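/- Fix an integer $b\ge 0$ and consider the $(1:b)$ Maker–Breaker game on the edges of the complete graph $K_n$: in every round Maker first claims one unclaimed edge, and then Breaker claims $b$ unclaimed edges (all the remaining ones if there are fewer than $b$), until every edge is claimed. In the $H$-subgraph game, Maker wins if the graph formed by his edges at the end contains $H$ as a (not necessarily induced) subgraph; otherwise Breaker wins. Let $p_{CC}(n,b)$ be $1$ if Maker has a winning strategy and $0$ otherwise. Let $p_{RC}(n,b)$ be the minimum, over all deterministic strategies of Breaker, of the probability that Maker wins when in every round he claims an edge chosen uniformly at random among the unclaimed edges. For $XY\in\{CC,RC\}$, a function $f(n)$ is called a sharp threshold, written $b^*_{XY}\approx f$, if for every $\varepsilon>0$ we have $p_{XY}(n,(1-\varepsilon)f(n))\to 1$ (if $\varepsilon<1$) and $p_{XY}(n,(1+\varepsilon)f(n))\to 0$ as $n\to\infty$, where biases are rounded down to integers. Let $H$ be a path with at least ten edges, or a three-legged spider (three paths, each with at least one edge, which share one endpoint and are otherwise disjoint) that contains a path with ten edges as a subgraph. Then, in the $H$-subgraph game, $b^*_{CC}\approx n$, but $b^*_{RC}\not\approx n$, that is, the function $n$ is not a sharp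 threshold when Maker plays randomly. In particular, $b^*_{CC}\not\approx b^*_{RC}$: there is no function $f$ with both $b^*_{CC}\approx f$ and $b^*_{RC}\approx f$. -/

import Mathlib

open Filter Topology
open scoped ENNReal

namespace BiasedGame

/-! ### Biased Maker-Breaker games on a finite board -/

section Game

variable {α : Type*} [DecidableEq α]

/-- The completed rounds of a game, most recent first. A round is the element claimed by Maker
together with the set of elements then claimed by Breaker. -/
abbrev History (α : Type*) := List (α × Finset α)

/-- The elements claimed by Maker. -/
def makerSet (h : History α) : Finset α := (h.map Prod.fst).toFinset

/-- The elements claimed by Breaker. -/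
def breakerSet (h : History α) : Finset α := h.foldr (fun r s => r.2 ∪ s) ∅

/-- The elements of the board `X` which nobody has claimed. -/
def free (X : Finset α) (h : History α) : Finset α := X \ (makerSet h ∪ breakerSet h)

/-- A deterministic strategy for Maker: whenever some element is free, it selects a free
element, depending on the whole history. -/
structure MakerStrategy (X : Finset α) where
  move : (h : History α) → (free X h).Nonempty → α
  legal : ∀ (h : History α) (hf : (free X h).Nonempty), move h hf ∈ free X h

/-- A deterministic strategy for Breaker in the `(1:b)` game: after Maker has claimed the free
element `e`, it selects `b` of the remaining free elements (all of them if there are fewer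
than `b`), depending on the whole history. -/
structure BreakerStrategy (X : Finset α) (b : ℕ) where
  move : History α → α → Finset α
  subset_free : ∀ (h : History α), ∀ e ∈ free X h, move h e ⊆ (free X h).erase e
  card_move : ∀ (h : History α), ∀ e ∈ free X h,
    (move h e).card = min b ((free X h).erase e).card

variable {X : Finset α} {b : ℕ}

/-- The history after (at most) `k` rounds when both players follow deterministic strategies;
play stops once the board is completely claimed. -/
def play (σ : MakerStrategy X) (τ : BreakerStrategy X b) : ℕ → History α
  | 0 => []
  | k + 1 =>
    let h := play σ τ k
    if hf : (free X h).Nonempty then (σ.move h hf, τ.move h (σ.move h hf)) :: h else h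

/-- The random history after (at most) `k` rounds when Maker claims in every round a uniformly
random free element and Breaker follows a deterministic strategy. -/
noncomputable def randomPlay (τ : BreakerStrategy X b) : ℕ → PMF (History α)
  | 0 => PMF.pure []
  | k + 1 =>
    (randomPlay τ k).bind fun h =>
      if hf : (free X h).Nonempty then
        (PMF.uniformOfFinset (free X h) hf).map fun e => (e, τ.move h e) :: h
      else PMF.pure h

/-- Every round claims at least one element, so the board is completely claimed after `X.card`
rounds. `Win S` says that Maker wins when his final set of elements is `S`. -/
def MakerHasWinningStrategy (X : Finset α) (b : ℕ) (Win : Finset α → Prop) : Prop :=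
  ∃ σ : MakerStrategy X, ∀ τ : BreakerStrategy X b, Win (makerSet (play σ τ X.card))

open Classical in
/-- The probability that CleverMaker wins against CleverBreaker: it is `1` if Maker has a winning
strategy, and `0` otherwise. -/
noncomputable def probCC (X : Finset α) (b : ℕ) (Win : Finset α → Prop) : ℝ≥0∞ :=
  if MakerHasWinningStrategy X b Win then 1 else 0

/-- The probability that RandomMaker wins against CleverBreaker, who follows a deterministic
strategy that makes this probability as small as possible. -/
noncomputable def probRC (X : Finset α) (b : ℕ) (Win : Finset α → Prop) : ℝ≥0∞ :=
  ⨅ τ : BreakerStrategy X b,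
    (randomPlay τ X.card).toOuterMeasure {h | Win (makerSet h)}

end Game

/-! ### Games on the edges of the complete graph -/

/-- A property of graphs on the vertex sets `Fin n`. -/
abbrev GraphProperty := (n : ℕ) → SimpleGraph (Fin n) → Prop

/-- The edge set of the complete graph on `n` vertices. -/
def board (n : ℕ) : Finset (Sym2 (Fin n)) := (⊤ : SimpleGraph (Fin n)).edgeFinset

/-- Maker wins if the graph formed by his edges has the property `P`. -/
def graphWin (P : GraphProperty) (n : ℕ) (S : Finset (Sym2 (Fin n))) : Prop :=
  P n (SimpleGraph.fromEdgeSet (S : Set (Sym2 (Fin n))))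

/-- The probability that CleverMaker wins against CleverBreaker in the `(1:b)` game on `n`
vertices defined by `P`. -/
noncomputable def graphProbCC (P : GraphProperty) (n b : ℕ) : ℝ≥0∞ :=
  probCC (board n) b (graphWin P n)

/-- The probability that RandomMaker wins against CleverBreaker in the `(1:b)` game on `n`
vertices defined by `P`. -/
noncomputable def graphProbRC (P : GraphProperty) (n b : ℕ) : ℝ≥0∞ :=
  probRC (board n) b (graphWin P n)

/-- `f` is a sharp threshold, where `p n b` is the probability that Maker wins the `(1:b)` game on
`n` vertices. Biases are rounded down; `ε < 1` only excludes the meaningless biases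
`(1 - ε) * f n ≤ 0`. -/
def IsSharpThreshold (p : ℕ → ℕ → ℝ≥0∞) (f : ℕ → ℝ) : Prop :=
  ∀ ε : ℝ, 0 < ε →
    (ε < 1 → Tendsto (fun n => p n ⌊(1 - ε) * f n⌋₊) atTop (𝓝 1)) ∧
    Tendsto (fun n => p n ⌊(1 + ε) * f n⌋₊) atTop (𝓝 0)

/-- The property of containing `H` as a (not necessarily induced) subgraph, which defines the
`H`-subgraph game. -/
def containsSubgraph {V : Type*} (H : SimpleGraph V) : GraphProperty :=
  fun _ M => H.IsContained M

/-! ### Paths and spiders -/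

/-- `H` is a path with `k` edges. -/
def IsPathWithEdges {V : Type*} (H : SimpleGraph V) (k : ℕ) : Prop :=
  Nonempty (H ≃g SimpleGraph.pathGraph (k + 1))

/-- Three paths with `ℓ 0`, `ℓ 1`, `ℓ 2` edges which share one endpoint, the vertex `none`, and
are otherwise disjoint. The vertex `some ⟨i, j⟩` is at distance `j + 1` from `none`. -/
def spider (ℓ : Fin 3 → ℕ) : SimpleGraph (Option (Σ i : Fin 3, Fin (ℓ i))) :=
  SimpleGraph.fromRel fun x y =>
    match x, y with
    | none, some ⟨_, j⟩ => (j : ℕ) = 0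
    | some ⟨i, j⟩, some ⟨i', j'⟩ => i = i' ∧ (j' : ℕ) = j + 1
    | _, none => False

/-- `H` is a three-legged spider (each leg having at least one edge). -/
def IsThreeLeggedSpider {V : Type*} (H : SimpleGraph V) : Prop :=
  ∃ ℓ : Fin 3 → ℕ, (∀ i, 0 < ℓ i) ∧ Nonempty (H ≃g spider ℓ)

end BiasedGame

/-! Call a vertex sealed if it has no free edge to the complement of `S`. For `b ≥ n`, take `S = ∅`.
Breaker keeps Maker's graph a star forest with sealed leaves. When Maker joins an untouched `x` to
`y`, Breaker takes every free edge at `x` and every free edge from `y` to a touched vertex. The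
former lead to unsealed vertices, the latter to touched unsealed ones (centres). A round adds at
most the centre `y` and at least the sealed vertex `x`, so centres never outnumber sealed vertices
and `n` edges are enough (`StarPosition.exists_required_outside`).

For `b ≤ (1 - ε) n`, Maker grows a path. Breaker has claimed only O(n) edges in boundedly many
rounds, so all but O(1) vertices have Breaker degree below `ε n / 4`. Maker moves to such a vertex,
and one reply of Breaker cannot block it. For a spider he first builds a very long path. Breaker
cannot have given all its inner vertices degree above `b + ε n / 4`, so a third leg can start at one
of them.

Against a random Maker a smaller bias is enough. Let `n = 100 m` and `99 m ≤ b ≤ 100 m`, and fix `S`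
with `2 m` vertices. The star forest is kept only outside `S`, which costs at most `98 m` edges per
round, and `m` spare edges go inside `S`. An edge of Maker meeting `S` requires sealing just one of
its ends in `S`, and the structure still contains no path with ten edges. It can fail only if Maker
claims a dangerous edge, that is, a free edge inside `S` meeting one of his edges. A move meeting
`S` creates at most `4 m` of these, but a random move rarely meets `S`, while Breaker removes `m`
per round. A quadratic potential bounds the failure probability by `1/500`, and after `4 m` rounds
no free edge remains inside `S`.

If `f` is a sharp threshold for the clever Maker, then `f` is asymptotic to `n`, so `(1 - 1/400) f`
lies in this window for large `n` divisible by 100. There the random Maker's winning probability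
does not tend to 1. -/

namespace BiasedGame

/-! ### Star positions, their preservation, and why they contain no long path -/

section Position

variable {V : Type*}

/-- No edge between `v` and the complement of `S` belongs to `F`. -/
def SealedOutside (S : Finset V) (F : Finset (Sym2 V)) (v : V) : Prop :=
  ∀ w ∉ S, s(v, w) ∉ F

/-- `v` has an `M`-neighbour outside `S`. -/
def TouchedOutside (S : Finset V) (M : Finset (Sym2 V)) (v : V) : Prop :=
  ∃ w ∉ S, s(v, w) ∈ M

theorem SealedOutside.mono {S : Finset V} {F F' : Finset (Sym2 V)} {x : V}
    (h : SealedOutside S F x) (hF : F' ⊆ F) : SealedOutside S F' x :=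
  fun w hw hf => h w hw (hF hf)

theorem touchedOutside_insert_iff [DecidableEq V] {S : Finset V} {M : Finset (Sym2 V)}
    {e : Sym2 V} {v : V} :
    TouchedOutside S (insert e M) v ↔ (∃ w ∉ S, s(v, w) = e) ∨ TouchedOutside S M v := by
  simp only [TouchedOutside, Finset.mem_insert]
  constructor
  · rintro ⟨w, hw, h | h⟩
    · exact Or.inl ⟨w, hw, h⟩
    · exact Or.inr ⟨w, hw, h⟩
  · rintro (⟨w, hw, h⟩ | ⟨w, hw, h⟩)
    · exact ⟨w, hw, Or.inl h⟩
    · exact ⟨w, hw, Or.inr h⟩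

theorem touchedOutside_insert_of_mem [DecidableEq V] {S : Finset V} {M : Finset (Sym2 V)}
    {x y v : V} (hx : x ∈ S) (hv : v ∉ S) :
    TouchedOutside S (insert s(x, y) M) v ↔ TouchedOutside S M v := by
  rw [touchedOutside_insert_iff]
  refine ⟨?_, Or.inr⟩
  rintro (⟨w, hw, h⟩ | h)
  · rw [Sym2.eq_iff] at h
    rcases h with ⟨rfl, _⟩ | ⟨_, rfl⟩
    · exact absurd hx hv
    · exact absurd hx hw
  · exact h

variable [Fintype V] [DecidableEq V]

open Classical in
/-- The vertices outside `S` without free edges outside `S`. -/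
noncomputable def sealedSet (S : Finset V) (F : Finset (Sym2 V)) : Finset V :=
  Sᶜ.filter (SealedOutside S F)

open Classical in
/-- The vertices outside `S` which are touched by Maker outside `S` but are not sealed. -/
noncomputable def centreSet (S : Finset V) (M F : Finset (Sym2 V)) : Finset V :=
  Sᶜ.filter fun v => TouchedOutside S M v ∧ ¬ SealedOutside S F v

/-- The positions, with Maker's edges `M` and free edges `F`, that Breaker maintains. Outside `S`
the graph of Maker is a star forest with sealed leaves. -/
structure StarPosition (S : Finset V) (M F : Finset (Sym2 V)) : Prop where
  irrefl : ∀ v, s(v, v) ∉ F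
  star : ∀ x ∉ S, ∀ y ∉ S, s(x, y) ∈ M →
    (SealedOutside S F x ∧ ∀ z ∉ S, s(x, z) ∈ M → z = y) ∨
    (SealedOutside S F y ∧ ∀ z ∉ S, s(y, z) ∈ M → z = x)
  touched : ∀ x ∉ S, ∀ y ∉ S, TouchedOutside S M x → TouchedOutside S M y → s(x, y) ∉ F
  card_le : (centreSet S M F).card ≤ (sealedSet S F).card
  pendant : ∀ x ∈ S, ∀ y ∉ S, s(x, y) ∈ M →
    SealedOutside S F x ∧ ∀ z ∉ S, s(x, z) ∈ M → z = y
  matching : ∀ x ∈ S, ∀ y ∈ S, s(x, y) ∈ M → ∀ z ∈ S, s(x, z) ∈ M → z = y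
  matching_sealed : ∀ x ∈ S, ∀ y ∈ S, s(x, y) ∈ M →
    (SealedOutside S F x ∧ ¬ TouchedOutside S M x) ∨
    (SealedOutside S F y ∧ ¬ TouchedOutside S M y)

variable {S : Finset V} {M F F' : Finset (Sym2 V)} {x y : V}

theorem sealedSet_subset (hF : F' ⊆ F) : sealedSet S F ⊆ sealedSet S F' := by
  classical
  intro v hv
  simp only [sealedSet, Finset.mem_filter] at hv ⊢
  exact ⟨hv.1, hv.2.mono hF⟩

/-- The untouched end `x` becomes a sealed leaf attached to `y`. The balance `card_le` survives
because only `y` can become a new centre, while `x` is newly sealed: before the move `s(x, y)`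
itself was free. -/
theorem StarPosition.insert_outside (h : StarPosition S M F) (hx : x ∉ S) (hy : y ∉ S)
    (hxy : s(x, y) ∈ F) (hxt : ¬ TouchedOutside S M x) (hF : F' ⊆ F)
    (hsx : SealedOutside S F' x)
    (hsy : ∀ w ∉ S, TouchedOutside S M w → s(y, w) ∉ F') :
    StarPosition S (insert s(x, y) M) F' := by
  classical
  have hne : x ≠ y := by rintro rfl; exact h.irrefl _ hxy
  have hyx : s(y, x) ∈ F := by rw [Sym2.eq_swap]; exact hxy
  have hcl : ∀ v ∉ S, TouchedOutside S (insert s(x, y) M) v →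
      v = x ∨ v = y ∨ TouchedOutside S M v := by
    intro v hv hvt
    rw [touchedOutside_insert_iff] at hvt
    rcases hvt with ⟨w, hw, hvw⟩ | hvt
    · rw [Sym2.eq_iff] at hvw; tauto
    · tauto
  refine ⟨fun v hv => h.irrefl v (hF hv), ?_, ?_, ?_, ?_, ?_, ?_⟩
  · have key : ∀ a ∉ S, ∀ b ∉ S, s(a, b) ∈ M → SealedOutside S F a →
        (∀ z ∉ S, s(a, z) ∈ M → z = b) →
        (SealedOutside S F' a ∧ ∀ z ∉ S, s(a, z) ∈ insert s(x, y) M → z = b) := by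
      intro a ha b hb hab hsa hu
      refine ⟨hsa.mono hF, fun z hz hm => ?_⟩
      rw [Finset.mem_insert] at hm
      rcases hm with hm | hm
      · rw [Sym2.eq_iff] at hm
        rcases hm with ⟨rfl, rfl⟩ | ⟨rfl, rfl⟩
        · exact absurd hxy (hsa _ hz)
        · exact absurd hyx (hsa _ hz)
      · exact hu z hz hm
    have hnew : SealedOutside S F' x ∧ ∀ z ∉ S, s(x, z) ∈ insert s(x, y) M → z = y := by
      refine ⟨hsx, fun z hz hm => ?_⟩
      rw [Finset.mem_insert] at hm
      rcases hm with hm | hm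
      · rw [Sym2.eq_iff] at hm
        rcases hm with ⟨_, rfl⟩ | ⟨rfl, rfl⟩
        · rfl
        · exact absurd rfl hne
      · exact absurd ⟨z, hz, hm⟩ hxt
    intro a ha b hb hab
    rw [Finset.mem_insert] at hab
    rcases hab with hab | hab
    · rw [Sym2.eq_iff] at hab
      rcases hab with ⟨rfl, rfl⟩ | ⟨rfl, rfl⟩
      · exact Or.inl hnew
      · exact Or.inr hnew
    · rcases h.star a ha b hb hab with ⟨h1, h2⟩ | ⟨h1, h2⟩
      · exact Or.inl (key a ha b hb hab h1 h2)
      · exact Or.inr (key b hb a ha (by rwa [Sym2.eq_swap]) h1 h2)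
  · intro a ha b hb hat hbt hab
    have hba : s(b, a) ∈ F' := by rwa [Sym2.eq_swap]
    rcases hcl a ha hat with rfl | rfl | hat'
    · exact hsx b hb hab
    · rcases hcl b hb hbt with rfl | rfl | hbt'
      · exact hsx a ha hba
      · exact h.irrefl _ (hF hab)
      · exact hsy b hb hbt' hab
    · rcases hcl b hb hbt with rfl | rfl | hbt'
      · exact hsx a ha hba
      · exact hsy a ha hat' hba
      · exact h.touched a ha b hb hat' hbt' (hF hab)
  · have h1 : centreSet S (insert s(x, y) M) F' ⊆ insert y (centreSet S M F) := by
      intro v hv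
      simp only [centreSet, Finset.mem_filter, Finset.mem_compl, Finset.mem_insert] at hv ⊢
      obtain ⟨hvS, hvt, hvs⟩ := hv
      rcases hcl v hvS hvt with rfl | rfl | hvt'
      · exact absurd hsx hvs
      · exact Or.inl rfl
      · exact Or.inr ⟨hvS, hvt', fun hs => hvs (hs.mono hF)⟩
    have h2 : insert x (sealedSet S F) ⊆ sealedSet S F' := by
      refine Finset.insert_subset ?_ (sealedSet_subset hF)
      simp only [sealedSet, Finset.mem_filter, Finset.mem_compl]
      exact ⟨hx, hsx⟩
    have h3 : x ∉ sealedSet S F := by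
      simp only [sealedSet, Finset.mem_filter, Finset.mem_compl]
      exact fun hh => hh.2 y hy hxy
    calc _ ≤ _ := Finset.card_le_card h1
      _ ≤ _ := Finset.card_insert_le _ _
      _ ≤ (sealedSet S F).card + 1 := by have := h.card_le; omega
      _ = _ := (Finset.card_insert_of_notMem h3).symm
      _ ≤ _ := Finset.card_le_card h2
  · intro a ha b hb hab
    have hold : ∀ z, s(a, z) ∈ insert s(x, y) M → s(a, z) ∈ M := by
      intro z hz
      rw [Finset.mem_insert, Sym2.eq_iff] at hz
      rcases hz with (⟨rfl, _⟩ | ⟨rfl, _⟩) | hz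
      · exact absurd ha hx
      · exact absurd ha hy
      · exact hz
    obtain ⟨h1, h2⟩ := h.pendant a ha b hb (hold b hab)
    exact ⟨h1.mono hF, fun z hz hm => h2 z hz (hold z hm)⟩
  · intro a ha b hb hab c hc hac
    have hold : ∀ z, s(a, z) ∈ insert s(x, y) M → s(a, z) ∈ M := by
      intro z hz
      rw [Finset.mem_insert, Sym2.eq_iff] at hz
      rcases hz with (⟨rfl, _⟩ | ⟨rfl, _⟩) | hz
      · exact absurd ha hx
      · exact absurd ha hy
      · exact hz
    exact h.matching a ha b hb (hold b hab) c hc (hold c hac)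
  · intro a ha b hb hab
    have hold : ∀ a ∈ S, ∀ z, s(a, z) ∈ insert s(x, y) M → s(a, z) ∈ M := by
      intro a ha z hz
      rw [Finset.mem_insert, Sym2.eq_iff] at hz
      rcases hz with (⟨rfl, _⟩ | ⟨rfl, _⟩) | hz
      · exact absurd ha hx
      · exact absurd ha hy
      · exact hz
    rcases h.matching_sealed a ha b hb (hold a ha b hab) with ⟨h1, h2⟩ | ⟨h1, h2⟩
    · exact Or.inl ⟨h1.mono hF, fun ⟨w, hw, hm⟩ => h2 ⟨w, hw, hold a ha w hm⟩⟩
    · exact Or.inr ⟨h1.mono hF, fun ⟨w, hw, hm⟩ => h2 ⟨w, hw, hold b hb w hm⟩⟩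

theorem StarPosition.card_le_insert (h : StarPosition S M F) (hx : x ∈ S) (hF : F' ⊆ F) :
    (centreSet S (insert s(x, y) M) F').card ≤ (sealedSet S F').card := by
  classical
  have h1 : centreSet S (insert s(x, y) M) F' ⊆ centreSet S M F := by
    intro v hv
    simp only [centreSet, Finset.mem_filter, Finset.mem_compl] at hv ⊢
    obtain ⟨hvS, hvt, hvs⟩ := hv
    exact ⟨hvS, (touchedOutside_insert_of_mem hx hvS).1 hvt, fun hs => hvs (hs.mono hF)⟩
  exact (Finset.card_le_card h1).trans
    (h.card_le.trans (Finset.card_le_card (sealedSet_subset hF)))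

theorem StarPosition.star_insert (h : StarPosition S M F) (hx : x ∈ S) (hF : F' ⊆ F) :
    ∀ a ∉ S, ∀ b ∉ S, s(a, b) ∈ insert s(x, y) M →
    (SealedOutside S F' a ∧ ∀ z ∉ S, s(a, z) ∈ insert s(x, y) M → z = b) ∨
    (SealedOutside S F' b ∧ ∀ z ∉ S, s(b, z) ∈ insert s(x, y) M → z = a) := by
  have hold : ∀ a ∉ S, ∀ b ∉ S, s(a, b) ∈ insert s(x, y) M → s(a, b) ∈ M := by
    intro a ha b hb hab
    rw [Finset.mem_insert, Sym2.eq_iff] at hab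
    rcases hab with (⟨rfl, _⟩ | ⟨_, rfl⟩) | hab
    · exact absurd hx ha
    · exact absurd hx hb
    · exact hab
  intro a ha b hb hab
  rcases h.star a ha b hb (hold a ha b hb hab) with ⟨h1, h2⟩ | ⟨h1, h2⟩
  · exact Or.inl ⟨h1.mono hF, fun z hz hm => h2 z hz (hold a ha z hz hm)⟩
  · exact Or.inr ⟨h1.mono hF, fun z hz hm => h2 z hz (hold b hb z hz hm)⟩

theorem StarPosition.touched_insert (h : StarPosition S M F) (hx : x ∈ S) (hF : F' ⊆ F) :
    ∀ a ∉ S, ∀ b ∉ S, TouchedOutside S (insert s(x, y) M) a →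
      TouchedOutside S (insert s(x, y) M) b → s(a, b) ∉ F' := by
  intro a ha b hb hat hbt hab
  exact h.touched a ha b hb ((touchedOutside_insert_of_mem hx ha).1 hat)
    ((touchedOutside_insert_of_mem hx hb).1 hbt) (hF hab)

/-- Sealing the end in `S` suffices: it hangs as a pendant at `y`, and touching outside `S` is
measured only by edges with both ends relevant to the complement, so `y` does not change status. If
`x` is matched inside `S`, the sealed untouched end of that edge is not `x`, since `s(x, y)` was
free. -/
theorem StarPosition.insert_crossing (h : StarPosition S M F) (hx : x ∈ S) (hy : y ∉ S)
    (hxy : s(x, y) ∈ F) (hF : F' ⊆ F) (hsx : SealedOutside S F' x) :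
    StarPosition S (insert s(x, y) M) F' := by
  have hold : ∀ a ∈ S, ∀ z ∈ S, s(a, z) ∈ insert s(x, y) M → s(a, z) ∈ M := by
    intro a ha z hz hm
    rw [Finset.mem_insert, Sym2.eq_iff] at hm
    rcases hm with (⟨_, rfl⟩ | ⟨rfl, _⟩) | hm
    · exact absurd hz hy
    · exact absurd ha hy
    · exact hm
  have hold' : ∀ a ∈ S, a ≠ x → ∀ z, s(a, z) ∈ insert s(x, y) M → s(a, z) ∈ M := by
    intro a ha hax z hm
    rw [Finset.mem_insert, Sym2.eq_iff] at hm
    rcases hm with (⟨rfl, _⟩ | ⟨rfl, _⟩) | hm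
    · exact absurd rfl hax
    · exact absurd ha hy
    · exact hm
  have hunt : ¬ TouchedOutside S M x := by
    rintro ⟨w, hw, hm⟩
    exact (h.pendant x hx w hw hm).1 y hy hxy
  refine ⟨fun v hv => h.irrefl v (hF hv), h.star_insert hx hF, h.touched_insert hx hF,
    h.card_le_insert hx hF, ?_, ?_, ?_⟩
  · intro a ha b hb hab
    by_cases hax : a = x
    · subst hax
      have : ∀ z ∉ S, s(a, z) ∈ insert s(a, y) M → z = y := by
        intro z hz hm
        rw [Finset.mem_insert, Sym2.eq_iff] at hm
        rcases hm with (⟨_, rfl⟩ | ⟨rfl, _⟩) | hm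
        · rfl
        · exact absurd ha hy
        · exact absurd ⟨z, hz, hm⟩ hunt
      refine ⟨hsx, fun z hz hm => ?_⟩
      rw [this z hz hm, this b hb hab]
    · obtain ⟨h1, h2⟩ := h.pendant a ha b hb (hold' a ha hax b hab)
      exact ⟨h1.mono hF, fun z hz hm => h2 z hz (hold' a ha hax z hm)⟩
  · intro a ha b hb hab c hc hac
    exact h.matching a ha b hb (hold a ha b hb hab) c hc (hold a ha c hc hac)
  · have key : ∀ a ∈ S, SealedOutside S F a → ¬ TouchedOutside S M a →
        SealedOutside S F' a ∧ ¬ TouchedOutside S (insert s(x, y) M) a := by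
      intro a ha h1 h2
      have hax : a ≠ x := by rintro rfl; exact h1 y hy hxy
      exact ⟨h1.mono hF, fun ⟨w, hw, hm⟩ => h2 ⟨w, hw, hold' a ha hax w hm⟩⟩
    intro a ha b hb hab
    rcases h.matching_sealed a ha b hb (hold a ha b hb hab) with ⟨h1, h2⟩ | ⟨h1, h2⟩
    · exact Or.inl (key a ha h1 h2)
    · exact Or.inr (key b hb h1 h2)

/-- For an edge that is not dangerous, both ends are new to Maker, so the edges inside `S` stay a
matching. Sealing `x` ensures that at most one end of the new edge can later gain a neighbour
outside `S`. -/
theorem StarPosition.insert_inside (h : StarPosition S M F) (hx : x ∈ S) (hy : y ∈ S)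
    (hxy : s(x, y) ∈ F) (hxM : ∀ z, s(x, z) ∉ M) (hyM : ∀ z, s(y, z) ∉ M) (hF : F' ⊆ F)
    (hsx : SealedOutside S F' x) :
    StarPosition S (insert s(x, y) M) F' := by
  have hne : x ≠ y := by rintro rfl; exact h.irrefl _ hxy
  have hold : ∀ a, ∀ z ∉ S, s(a, z) ∈ insert s(x, y) M → s(a, z) ∈ M := by
    intro a z hz hm
    rw [Finset.mem_insert, Sym2.eq_iff] at hm
    rcases hm with (⟨_, rfl⟩ | ⟨_, rfl⟩) | hm
    · exact absurd hy hz
    · exact absurd hx hz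
    · exact hm
  refine ⟨fun v hv => h.irrefl v (hF hv), h.star_insert hx hF, h.touched_insert hx hF,
    h.card_le_insert hx hF, ?_, ?_, ?_⟩
  · intro a ha b hb hab
    obtain ⟨h1, h2⟩ := h.pendant a ha b hb (hold a b hb hab)
    exact ⟨h1.mono hF, fun z hz hm => h2 z hz (hold a z hz hm)⟩
  · intro a ha b hb hab c hc hac
    rw [Finset.mem_insert, Sym2.eq_iff] at hab hac
    rcases hab with (⟨rfl, rfl⟩ | ⟨rfl, rfl⟩) | hab
    · rcases hac with (⟨_, h2⟩ | ⟨rfl, _⟩) | hac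
      · exact h2
      · exact absurd rfl hne
      · exact absurd hac (hxM _)
    · rcases hac with (⟨rfl, _⟩ | ⟨_, h2⟩) | hac
      · exact absurd rfl hne
      · exact h2
      · exact absurd hac (hyM _)
    · rcases hac with (⟨rfl, _⟩ | ⟨rfl, _⟩) | hac
      · exact absurd hab (hxM _)
      · exact absurd hab (hyM _)
      · exact h.matching a ha b hb hab c hc hac
  · have hxu : ¬ TouchedOutside S (insert s(x, y) M) x := by
      rintro ⟨w, hw, hm⟩
      exact hxM w (hold x w hw hm)
    intro a ha b hb hab
    rw [Finset.mem_insert, Sym2.eq_iff] at hab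
    rcases hab with (⟨rfl, rfl⟩ | ⟨rfl, rfl⟩) | hab
    · exact Or.inl ⟨hsx, hxu⟩
    · exact Or.inr ⟨hsx, hxu⟩
    · rcases h.matching_sealed a ha b hb hab with ⟨h1, h2⟩ | ⟨h1, h2⟩
      · exact Or.inl ⟨h1.mono hF, fun ⟨w, hw, hm⟩ => h2 ⟨w, hw, hold a w hw hm⟩⟩
      · exact Or.inr ⟨h1.mono hF, fun ⟨w, hw, hm⟩ => h2 ⟨w, hw, hold b w hw hm⟩⟩

/-- In a star position Maker has no path with ten edges. -/
theorem StarPosition.not_isContained (h : StarPosition S M F) :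
    ¬ (SimpleGraph.pathGraph 11).IsContained
      (SimpleGraph.fromEdgeSet (M : Set (Sym2 V))) := by
  rintro ⟨f⟩
  have hinj : Function.Injective f := f.injective
  have hadj : ∀ i j : Fin 11, (i : ℕ) + 1 = j → s(f i, f j) ∈ M := by
    intro i j hij
    have h1 : (SimpleGraph.pathGraph 11).Adj i j := by
      rw [SimpleGraph.pathGraph_adj]; exact Or.inl hij
    have h2 := f.toHom.map_adj h1
    simpa using (SimpleGraph.fromEdgeSet_adj _ |>.1 h2).1
  -- Vertices of `S` occur only near the ends of a path. Two outside neighbours of `f c` contradict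
  -- `pendant`, and two in `S` contradict `matching`. With one in `S`, an end of that matching edge
  -- is untouched, so the path cannot continue beyond it.
  have hout : ∀ a b c d e : Fin 11, (a : ℕ) + 1 = b → (b : ℕ) + 1 = c → (c : ℕ) + 1 = d →
      (d : ℕ) + 1 = e → f c ∉ S := by
    intro a b c d e hab hbc hcd hde hc
    have eab := hadj a b hab
    have ebc := hadj b c hbc
    have ecd := hadj c d hcd
    have ede := hadj d e hde
    have hbd : f b ≠ f d := fun hh => by
      have := congrArg Fin.val (hinj hh); omega
    have hac : f a ≠ f c := fun hh => by
      have := congrArg Fin.val (hinj hh); omega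
    have hce : f c ≠ f e := fun hh => by
      have := congrArg Fin.val (hinj hh); omega
    have key : ∀ p u v : V, s(p, u) ∈ M → s(u, f c) ∈ M → s(f c, v) ∈ M → u ≠ v → p ≠ f c →
        u ∈ S → False := by
      intro p u v hpu huc hcv huv hpc hu
      by_cases hv : v ∈ S
      · exact huv (h.matching _ hc v hv hcv u hu (by rwa [Sym2.eq_swap]))
      · rcases h.matching_sealed u hu _ hc huc with ⟨_, h2⟩ | ⟨_, h2⟩
        · by_cases hp : p ∈ S
          · exact hpc (h.matching u hu _ hc huc p hp (by rwa [Sym2.eq_swap]))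
          · exact h2 ⟨p, hp, by rwa [Sym2.eq_swap]⟩
        · exact h2 ⟨v, hv, hcv⟩
    by_cases hb : f b ∈ S
    · exact key (f a) (f b) (f d) eab ebc ecd hbd hac hb
    · by_cases hd : f d ∈ S
      · exact key (f e) (f d) (f b) (by rwa [Sym2.eq_swap]) (by rwa [Sym2.eq_swap])
          (by rwa [Sym2.eq_swap]) hbd.symm hce.symm hd
      · exact hbd ((h.pendant _ hc _ hd ecd).2 _ hb (by rwa [Sym2.eq_swap]))
  have h2 := hout 0 1 2 3 4 rfl rfl rfl rfl
  have h3 := hout 1 2 3 4 5 rfl rfl rfl rfl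
  have h4 := hout 2 3 4 5 6 rfl rfl rfl rfl
  have h5 := hout 3 4 5 6 7 rfl rfl rfl rfl
  -- Four consecutive path vertices lie outside `S`, but the middle edge of a path with three edges
  -- has no leaf end.
  rcases h.star _ h3 _ h4 (hadj 3 4 rfl) with ⟨_, hu⟩ | ⟨_, hu⟩
  · have := hinj (hu _ h2 (by rw [Sym2.eq_swap]; exact hadj 2 3 rfl))
    exact absurd this (by decide)
  · have := hinj (hu _ h5 (hadj 4 5 rfl))
    exact absurd this (by decide)

theorem starPosition_empty (hF : ∀ v, s(v, v) ∉ F) : StarPosition S ∅ F := by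
  classical
  refine ⟨hF, by simp, ?_, ?_, by simp, by simp, by simp⟩
  · rintro x _ y _ ⟨w, _, hw⟩
    simp at hw
  · have : centreSet S ∅ F = ∅ := by
      ext v; simp [centreSet, TouchedOutside]
    simp [this]

end Position

/-! ### Breaker's reply: the required edges and the spare edges -/

section Reply

variable {V : Type*}

open Classical in
/-- The edges of `F` inside `S`. -/
noncomputable def insideEdges (S : Finset V) (F : Finset (Sym2 V)) : Finset (Sym2 V) :=
  F.filter fun e => ∀ v ∈ e, v ∈ S

theorem insideEdges_subset (S : Finset V) (F : Finset (Sym2 V)) : insideEdges S F ⊆ F := by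
  classical exact Finset.filter_subset _ _

open Classical in
/-- The edges of `F` inside `S` which meet an edge of Maker. -/
noncomputable def dangerousEdges (S : Finset V) (M F : Finset (Sym2 V)) : Finset (Sym2 V) :=
  F.filter fun e => (∀ v ∈ e, v ∈ S) ∧ ∃ v ∈ e, ∃ e' ∈ M, v ∈ e'

open Classical in
/-- An upper bound for the number of new dangerous edges when Maker claims `e`. -/
noncomputable def dangerIncrement (S : Finset V) (e : Sym2 V) : ℕ :=
  if ∃ v ∈ e, v ∈ S then 2 * S.card else 0

theorem card_dangerousEdges_insert_le [DecidableEq V] {S : Finset V} {M F : Finset (Sym2 V)}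
    (e : Sym2 V) :
    (dangerousEdges S (insert e M) F).card ≤
      (dangerousEdges S M F).card + dangerIncrement S e := by
  classical
  induction e using Sym2.ind with
  | _ x y =>
    by_cases hS : ∃ v ∈ s(x, y), v ∈ S
    · rw [dangerIncrement, if_pos hS]
      have hsub : dangerousEdges S (insert s(x, y) M) F ⊆ dangerousEdges S M F ∪
          ((S.image fun w => s(x, w)) ∪ S.image fun w => s(y, w)) := by
        intro f hf
        simp only [dangerousEdges, Finset.mem_filter, Finset.mem_union, Finset.mem_image,
          Finset.mem_insert] at hf ⊢
        obtain ⟨hfF, hfS, v, hv, e', he', hve'⟩ := hf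
        rcases he' with rfl | he'
        · obtain ⟨w, rfl⟩ := Sym2.mem_iff_exists.1 hv
          have hw : w ∈ S := hfS w (Sym2.mem_mk_right _ _)
          rcases Sym2.mem_iff.1 hve' with rfl | rfl
          · exact Or.inr (Or.inl ⟨w, hw, rfl⟩)
          · exact Or.inr (Or.inr ⟨w, hw, rfl⟩)
        · exact Or.inl ⟨hfF, hfS, v, hv, e', he', hve'⟩
      have h1 := Finset.card_le_card hsub
      have h2 := Finset.card_union_le (dangerousEdges S M F)
        ((S.image fun w => s(x, w)) ∪ S.image fun w => s(y, w))
      have h3 := Finset.card_union_le (S.image fun w => s(x, w)) (S.image fun w => s(y, w))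
      have h4 : (S.image fun w => s(x, w)).card ≤ S.card := Finset.card_image_le
      have h5 : (S.image fun w => s(y, w)).card ≤ S.card := Finset.card_image_le
      omega
    · refine le_trans (Finset.card_le_card ?_) (Nat.le_add_right _ _)
      intro f hf
      simp only [dangerousEdges, Finset.mem_filter, Finset.mem_insert] at hf ⊢
      obtain ⟨hfF, hfS, v, hv, e', rfl | he', hve'⟩ := hf
      · exact absurd ⟨v, hve', hfS v hv⟩ hS
      · exact ⟨hfF, hfS, v, hv, e', he', hve'⟩

/-- Serves to spend `k` spare edges inside `S`, with elements outside `D` chosen only once `D` is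
exhausted. -/
theorem exists_greedy_subset {β : Type*} {D I : Finset β} (h : D ⊆ I) (k : ℕ) :
    ∃ W ⊆ I, W.card = min k I.card ∧ (W ⊆ D ∨ D ⊆ W) := by
  have hc := Finset.card_le_card h
  rcases le_total k D.card with hk | hk
  · obtain ⟨W, hW, hWc⟩ := Finset.exists_subset_card_eq hk
    exact ⟨W, hW.trans h, by omega, Or.inl hW⟩
  · obtain ⟨W, hW, hWI, hWc⟩ := Finset.exists_subsuperset_card_eq h
      (show D.card ≤ min k I.card by omega) (by omega)
    exact ⟨W, hWI, hWc, Or.inr hW⟩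

variable [Fintype V] [DecidableEq V] {S : Finset V} {M F F' : Finset (Sym2 V)}

/-- Edges sealing `x` lead to unsealed vertices, at most `|Sᶜ|` minus the number of sealed ones.
Edges from `y` to touched vertices lead to centres, at most as many as there are sealed vertices by
`card_le`. The sum is at most `|Sᶜ|`. -/
theorem StarPosition.exists_required_outside (h : StarPosition S M F) {x y : V} (hx : x ∉ S)
    (hy : y ∉ S) (hxy : s(x, y) ∈ F) (hxt : ¬ TouchedOutside S M x) :
    ∃ Q ⊆ F.erase s(x, y), Q.card ≤ Sᶜ.card ∧
      ∀ F' ⊆ F.erase s(x, y), Disjoint F' Q → StarPosition S (insert s(x, y) M) F' := by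
  classical
  set A := (F.erase s(x, y)).filter fun f => ∃ w ∉ S, f = s(x, w) with hA
  set B := (F.erase s(x, y)).filter fun f => ∃ w ∉ S, TouchedOutside S M w ∧ f = s(y, w) with hB
  refine ⟨A ∪ B, Finset.union_subset (Finset.filter_subset _ _) (Finset.filter_subset _ _),
    ?_, ?_⟩
  · have hAc : A ⊆ (Sᶜ \ sealedSet S F).image fun w => s(x, w) := by
      intro f hf
      simp only [hA, Finset.mem_filter, Finset.mem_erase] at hf
      obtain ⟨⟨_, hfF⟩, w, hw, rfl⟩ := hf
      refine Finset.mem_image.2 ⟨w, ?_, rfl⟩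
      simp only [sealedSet, Finset.mem_sdiff, Finset.mem_compl, Finset.mem_filter, not_and]
      refine ⟨hw, fun _ hs => hs x hx ?_⟩
      rwa [Sym2.eq_swap]
    have hBc : B ⊆ (centreSet S M F).image fun w => s(y, w) := by
      intro f hf
      simp only [hB, Finset.mem_filter, Finset.mem_erase] at hf
      obtain ⟨⟨_, hfF⟩, w, hw, hwt, rfl⟩ := hf
      refine Finset.mem_image.2 ⟨w, ?_, rfl⟩
      simp only [centreSet, Finset.mem_compl, Finset.mem_filter]
      refine ⟨hw, hwt, fun hs => hs y hy ?_⟩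
      rwa [Sym2.eq_swap]
    have hsub : sealedSet S F ⊆ Sᶜ := Finset.filter_subset _ _
    have h1 := (Finset.card_le_card hAc).trans Finset.card_image_le
    have h2 := (Finset.card_le_card hBc).trans Finset.card_image_le
    have h3 := Finset.card_sdiff_of_subset hsub
    have h4 := Finset.card_le_card hsub
    have h5 := Finset.card_union_le A B
    have h6 := h.card_le
    omega
  · intro F' hF' hd
    refine h.insert_outside hx hy hxy hxt (hF'.trans (Finset.erase_subset _ _)) ?_ ?_
    · intro w hw hf
      exact Finset.disjoint_left.1 hd hf (Finset.mem_union_left _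
        (Finset.mem_filter.2 ⟨hF' hf, w, hw, rfl⟩))
    · intro w hw hwt hf
      exact Finset.disjoint_left.1 hd hf (Finset.mem_union_right _
        (Finset.mem_filter.2 ⟨hF' hf, w, hw, hwt, rfl⟩))

theorem exists_sealing_set (S : Finset V) (F : Finset (Sym2 V)) (x : V) :
    ∃ Q ⊆ F, Q.card ≤ Sᶜ.card ∧ ∀ F' ⊆ F, Disjoint F' Q → SealedOutside S F' x := by
  classical
  refine ⟨F.filter fun f => ∃ w ∉ S, f = s(x, w), Finset.filter_subset _ _, ?_, ?_⟩
  · have : (F.filter fun f => ∃ w ∉ S, f = s(x, w)) ⊆ Sᶜ.image fun w => s(x, w) := by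
      intro f hf
      obtain ⟨_, w, hw, rfl⟩ := Finset.mem_filter.1 hf
      exact Finset.mem_image.2 ⟨w, Finset.mem_compl.2 hw, rfl⟩
    exact (Finset.card_le_card this).trans Finset.card_image_le
  · intro F' hF' hd w hw hf
    exact Finset.disjoint_left.1 hd hf (Finset.mem_filter.2 ⟨hF' hf, w, hw, rfl⟩)

/-- Breaker has to claim at most `|Sᶜ|` edges to maintain a star position, unless Maker claims a
dangerous edge. -/
theorem StarPosition.exists_required (h : StarPosition S M F) {e : Sym2 V} (he : e ∈ F)
    (hd : e ∉ dangerousEdges S M F) :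
    ∃ Q ⊆ F.erase e, Q.card ≤ Sᶜ.card ∧
      ∀ F' ⊆ F.erase e, Disjoint F' Q → StarPosition S (insert e M) F' := by
  induction e using Sym2.ind with
  | _ x y =>
    by_cases hx : x ∈ S
    · obtain ⟨Q, hQ, hc, hs⟩ := exists_sealing_set S (F.erase s(x, y)) x
      refine ⟨Q, hQ, hc, fun F' hF' hdis => ?_⟩
      have hF := hF'.trans (Finset.erase_subset _ _)
      by_cases hy : y ∈ S
      · simp only [dangerousEdges, Finset.mem_filter, Sym2.mem_iff, not_and] at hd
        have hd' := hd he (by rintro v (rfl | rfl) <;> assumption)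
        exact h.insert_inside hx hy he
          (fun z hz => hd' ⟨x, Or.inl rfl, _, hz, Sym2.mem_mk_left _ _⟩)
          (fun z hz => hd' ⟨y, Or.inr rfl, _, hz, Sym2.mem_mk_left _ _⟩) hF (hs F' hF' hdis)
      · exact h.insert_crossing hx hy he hF (hs F' hF' hdis)
    · by_cases hy : y ∈ S
      · rw [Sym2.eq_swap] at he ⊢
        obtain ⟨Q, hQ, hc, hs⟩ := exists_sealing_set S (F.erase s(y, x)) y
        exact ⟨Q, hQ, hc, fun F' hF' hdis => h.insert_crossing hy hx he
          (hF'.trans (Finset.erase_subset _ _)) (hs F' hF' hdis)⟩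
      -- A free edge outside `S` never joins two touched vertices, so one end can play the role of
      -- the new leaf.
      · by_cases hxt : TouchedOutside S M x
        · have hyt : ¬ TouchedOutside S M y := fun hyt => h.touched x hx y hy hxt hyt he
          rw [Sym2.eq_swap] at he ⊢
          exact h.exists_required_outside hy hx he hyt
        · exact h.exists_required_outside hx hy he hxt

/-- Breaker maintains a star position and claims at least `k` further edges inside `S`, giving
preference to the dangerous ones. -/
theorem StarPosition.exists_reply (h : StarPosition S M F) {e : Sym2 V} (he : e ∈ F)
    (hd : e ∉ dangerousEdges S M F) {b k : ℕ} (hb : Sᶜ.card + k ≤ b) :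
    ∃ Q ⊆ F.erase e, Q.card = min b (F.erase e).card ∧
      StarPosition S (insert e M) (F.erase e \ Q) ∧
      (insideEdges S (F.erase e \ Q)).card ≤ (insideEdges S F).card - k ∧
      (dangerousEdges S (insert e M) (F.erase e \ Q)).card ≤
        (dangerousEdges S M F).card + dangerIncrement S e - k := by
  classical
  obtain ⟨Q₀, hQ₀, hc, hstar⟩ := h.exists_required he hd
  set I := insideEdges S (F.erase e) with hI
  set D := dangerousEdges S (insert e M) (F.erase e) with hD
  have hDI : D ⊆ I := by
    intro f hf
    simp only [hD, hI, dangerousEdges, insideEdges, Finset.mem_filter] at hf ⊢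
    exact ⟨hf.1, hf.2.1⟩
  have hIF : I ⊆ F.erase e := insideEdges_subset S _
  obtain ⟨W, hWI, hWc, hWD⟩ := exists_greedy_subset hDI k
  have hsub : Q₀ ∪ W ⊆ F.erase e := Finset.union_subset hQ₀ (hWI.trans hIF)
  have h1 := Finset.card_union_le Q₀ W
  have h2 := Finset.card_le_card hsub
  obtain ⟨Q, hQ, hQF, hQc⟩ := Finset.exists_subsuperset_card_eq hsub
    (show (Q₀ ∪ W).card ≤ min b (F.erase e).card by omega) (by omega)
  have hQ₀Q : Q₀ ⊆ Q := Finset.union_subset_left hQ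
  have hWQ : W ⊆ Q := Finset.union_subset_right hQ
  have hnot : ∀ f ∈ F.erase e \ Q, f ∉ W := fun f hf hw => (Finset.mem_sdiff.1 hf).2 (hWQ hw)
  refine ⟨Q, hQF, hQc, hstar _ Finset.sdiff_subset ?_, ?_, ?_⟩
  · exact Finset.disjoint_left.2 fun f hf hq => (Finset.mem_sdiff.1 hf).2 (hQ₀Q hq)
  · have h3 : insideEdges S (F.erase e \ Q) ⊆ I \ W := by
      intro f hf
      simp only [insideEdges, Finset.mem_filter] at hf
      simp only [hI, insideEdges, Finset.mem_sdiff, Finset.mem_filter]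
      exact ⟨⟨(Finset.mem_sdiff.1 hf.1).1, hf.2⟩, hnot f hf.1⟩
    have h4 : I ⊆ insideEdges S F := by
      intro f hf
      simp only [hI, insideEdges, Finset.mem_filter] at hf ⊢
      exact ⟨Finset.erase_subset _ _ hf.1, hf.2⟩
    have := Finset.card_le_card h3
    have := Finset.card_le_card h4
    have := Finset.card_sdiff_of_subset hWI
    omega
  · have h3 : dangerousEdges S (insert e M) (F.erase e \ Q) ⊆ D \ W := by
      intro f hf
      simp only [dangerousEdges, Finset.mem_filter] at hf
      simp only [hD, dangerousEdges, Finset.mem_sdiff, Finset.mem_filter]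
      exact ⟨⟨(Finset.mem_sdiff.1 hf.1).1, hf.2⟩, hnot f hf.1⟩
    have h4 : D.card ≤ (dangerousEdges S M F).card + dangerIncrement S e := by
      refine le_trans (Finset.card_le_card ?_) (card_dangerousEdges_insert_le e)
      intro f hf
      simp only [hD, dangerousEdges, Finset.mem_filter] at hf ⊢
      exact ⟨Finset.erase_subset _ _ hf.1, hf.2⟩
    have h5 := Finset.card_le_card h3
    -- The subtraction is truncated: either `W` consists of `k` dangerous edges, or no dangerous
    -- edge survives.
    have h6 : (D \ W).card ≤ D.card - k := by
      rcases hWD with hWD | hWD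
      · have := Finset.card_sdiff_of_subset hWD
        have := Finset.card_le_card hDI
        have := Finset.card_le_card hWD
        by_cases hk : k ≤ I.card
        · omega
        · have : W = I := Finset.eq_of_subset_of_card_le hWI (by omega)
          have : D ⊆ W := this ▸ hDI
          rw [Finset.sdiff_eq_empty_iff_subset.2 this]
          simp
      · rw [Finset.sdiff_eq_empty_iff_subset.2 hWD]
        simp
    omega

end Reply

/-! ### Histories, and strategies built from local replies -/

section Strategy

variable {α : Type*} [DecidableEq α]

@[simp] theorem makerSet_nil : makerSet ([] : History α) = ∅ := rfl

@[simp] theorem breakerSet_nil : breakerSet ([] : History α) = ∅ := rfl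

@[simp] theorem makerSet_cons (r : α × Finset α) (h : History α) :
    makerSet (r :: h) = insert r.1 (makerSet h) := by
  simp [makerSet]

@[simp] theorem breakerSet_cons (r : α × Finset α) (h : History α) :
    breakerSet (r :: h) = r.2 ∪ breakerSet h := rfl

theorem free_cons (X : Finset α) (r : α × Finset α) (h : History α) :
    free X (r :: h) = (free X h).erase r.1 \ r.2 := by
  ext a
  simp only [free, makerSet_cons, breakerSet_cons, Finset.mem_sdiff, Finset.mem_union,
    Finset.mem_insert, Finset.mem_erase]
  tauto

/-- A strategy of Breaker that picks moves with a given property whenever there are any. -/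
theorem exists_breakerStrategy (X : Finset α) (b : ℕ) (P : History α → α → Finset α → Prop) :
    ∃ τ : BreakerStrategy X b, ∀ h, ∀ e ∈ free X h,
      (∃ Q ⊆ (free X h).erase e, Q.card = min b ((free X h).erase e).card ∧ P h e Q) →
        P h e (τ.move h e) := by
  classical
  have hex : ∀ h : History α, ∀ e : α, ∃ Q ⊆ (free X h).erase e,
      Q.card = min b ((free X h).erase e).card ∧
      ((∃ Q ⊆ (free X h).erase e, Q.card = min b ((free X h).erase e).card ∧ P h e Q) →
        P h e Q) := by
    intro h e
    by_cases hQ : ∃ Q ⊆ (free X h).erase e, Q.card = min b ((free X h).erase e).card ∧ P h e Q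
    · obtain ⟨Q, h1, h2, h3⟩ := hQ
      exact ⟨Q, h1, h2, fun _ => h3⟩
    · obtain ⟨Q, h1, h2⟩ := Finset.exists_subset_card_eq (s := (free X h).erase e)
        (n := min b ((free X h).erase e).card) (by omega)
      exact ⟨Q, h1, h2, fun h3 => absurd h3 hQ⟩
  choose f hf1 hf2 hf3 using hex
  exact ⟨⟨f, fun h e _ => hf1 h e, fun h e _ => hf2 h e⟩, fun h e _ => hf3 h e⟩

end Strategy

/-! ### Breaker's strategy on the complete graph; Breaker wins when `b ≥ n` -/

section Board

theorem mem_board {n : ℕ} {x y : Fin n} : s(x, y) ∈ board n ↔ x ≠ y := by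
  simp [board]

/-- The strategy of Breaker derived from `StarPosition.exists_reply`. -/
theorem exists_starStrategy (n b k : ℕ) (S : Finset (Fin n)) (hb : Sᶜ.card + k ≤ b) :
    ∃ τ : BreakerStrategy (board n) b, ∀ h, ∀ e ∈ free (board n) h,
      StarPosition S (makerSet h) (free (board n) h) →
      e ∉ dangerousEdges S (makerSet h) (free (board n) h) →
      StarPosition S (makerSet ((e, τ.move h e) :: h)) (free (board n) ((e, τ.move h e) :: h)) ∧
      (insideEdges S (free (board n) ((e, τ.move h e) :: h))).card ≤
        (insideEdges S (free (board n) h)).card - k ∧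
      (dangerousEdges S (makerSet ((e, τ.move h e) :: h))
          (free (board n) ((e, τ.move h e) :: h))).card ≤
        (dangerousEdges S (makerSet h) (free (board n) h)).card + dangerIncrement S e - k := by
  obtain ⟨τ, hτ⟩ := exists_breakerStrategy (board n) b fun h e Q =>
    StarPosition S (makerSet h) (free (board n) h) →
      e ∉ dangerousEdges S (makerSet h) (free (board n) h) →
      StarPosition S (makerSet ((e, Q) :: h)) (free (board n) ((e, Q) :: h)) ∧
      (insideEdges S (free (board n) ((e, Q) :: h))).card ≤
        (insideEdges S (free (board n) h)).card - k ∧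
      (dangerousEdges S (makerSet ((e, Q) :: h)) (free (board n) ((e, Q) :: h))).card ≤
        (dangerousEdges S (makerSet h) (free (board n) h)).card + dangerIncrement S e - k
  refine ⟨τ, fun h e he hs hd => hτ h e he ?_ hs hd⟩
  obtain ⟨Q, h1, h2, h3⟩ := hs.exists_reply he hd hb
  refine ⟨Q, h1, h2, fun _ _ => ?_⟩
  simpa only [makerSet_cons, free_cons] using h3

theorem starPosition_nil (n : ℕ) (S : Finset (Fin n)) :
    StarPosition S (makerSet []) (free (board n) []) := by
  refine starPosition_empty fun v hv => ?_
  simp only [free, Finset.mem_sdiff] at hv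
  exact mem_board.1 hv.1 rfl

theorem not_containsSubgraph_of_starPosition {V : Type*} {H : SimpleGraph V}
    (hH : (SimpleGraph.pathGraph 11).IsContained H) {n : ℕ} {S : Finset (Fin n)}
    {M F : Finset (Sym2 (Fin n))} (h : StarPosition S M F) :
    ¬ graphWin (containsSubgraph H) n M :=
  fun hw => h.not_isContained (hH.trans hw)

/-- With `S = ∅` no edge is dangerous, so the star position persists against every Maker, and no
spare edges are needed. -/
theorem graphProbCC_eq_zero {V : Type*} {H : SimpleGraph V}
    (hH : (SimpleGraph.pathGraph 11).IsContained H) {n b : ℕ} (hb : n ≤ b) :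
    graphProbCC (containsSubgraph H) n b = 0 := by
  classical
  rw [graphProbCC, probCC, if_neg]
  rintro ⟨σ, hσ⟩
  obtain ⟨τ, hτ⟩ := exists_starStrategy n b 0 ∅ (by simpa using hb)
  have hd : ∀ M F : Finset (Sym2 (Fin n)), dangerousEdges ∅ M F = ∅ := by
    intro M F
    ext e
    induction e using Sym2.ind with
    | _ x y =>
      simp only [dangerousEdges, Finset.mem_filter, Finset.notMem_empty, iff_false]
      exact fun h => h.2.1 x (Sym2.mem_mk_left _ _)
  have key : ∀ k, StarPosition ∅ (makerSet (play σ τ k)) (free (board n) (play σ τ k)) := by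
    intro k
    induction k with
    | zero => exact starPosition_nil n ∅
    | succ k ih =>
      rw [play]
      by_cases hf : (free (board n) (play σ τ k)).Nonempty
      · simp only [hf, dite_true]
        exact (hτ _ _ (σ.legal _ hf) ih (by rw [hd]; simp)).1
      · simp only [hf, dite_false]
        exact ih
  exact not_containsSubgraph_of_starPosition hH (key _) (hσ τ)

end Board

/-! ### Expectations along random play -/

section Expectation

theorem tsum_bind_mul {β γ : Type*} (p : PMF β) (f : β → PMF γ) (Φ : γ → ℝ≥0∞) :
    ∑' c, p.bind f c * Φ c = ∑' a, p a * ∑' c, f a c * Φ c := by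
  simp only [PMF.bind_apply, ← ENNReal.tsum_mul_right]
  rw [ENNReal.tsum_comm]
  refine tsum_congr fun a => ?_
  rw [← ENNReal.tsum_mul_left]
  exact tsum_congr fun c => mul_assoc _ _ _

theorem tsum_pure_mul {β : Type*} (a : β) (Φ : β → ℝ≥0∞) :
    ∑' c, PMF.pure a c * Φ c = Φ a := by
  rw [tsum_eq_single a]
  · simp
  · intro c hc
    simp [hc]

theorem tsum_map_uniformOfFinset_mul {β γ : Type*} (s : Finset β) (hs : s.Nonempty) (g : β → γ)
    (Φ : γ → ℝ≥0∞) :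
    ∑' c, (PMF.uniformOfFinset s hs).map g c * Φ c = (s.card : ℝ≥0∞)⁻¹ * ∑ e ∈ s, Φ (g e) := by
  have hmap : (PMF.uniformOfFinset s hs).map g =
      (PMF.uniformOfFinset s hs).bind fun a => PMF.pure (g a) := rfl
  rw [hmap, tsum_bind_mul, Finset.mul_sum, tsum_eq_sum (s := s)]
  · refine Finset.sum_congr rfl fun a ha => ?_
    rw [tsum_pure_mul, PMF.uniformOfFinset_apply_of_mem hs ha]
  · intro a ha
    rw [PMF.uniformOfFinset_apply_of_notMem hs ha, zero_mul]

variable {α : Type*} [DecidableEq α] {X : Finset α} {b : ℕ}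

/-- A function whose conditional expectation grows by at most `c` in a round. -/
theorem randomPlay_step (τ : BreakerStrategy X b) (k : ℕ) (Φ Φ' : History α → ℝ≥0∞) (c : ℝ≥0∞)
    (h₁ : ∀ h, (free X h).Nonempty →
      ∑ e ∈ free X h, Φ' ((e, τ.move h e) :: h) ≤ (free X h).card * (Φ h + c))
    (h₂ : ∀ h, ¬ (free X h).Nonempty → Φ' h ≤ Φ h + c) :
    ∑' h, randomPlay τ (k + 1) h * Φ' h ≤ ∑' h, randomPlay τ k h * Φ h + c := by
  rw [randomPlay, tsum_bind_mul]
  calc _ ≤ ∑' h, randomPlay τ k h * (Φ h + c) := by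
        refine ENNReal.tsum_le_tsum fun h => ?_
        gcongr
        by_cases hf : (free X h).Nonempty
        · simp only [hf, dite_true]
          rw [tsum_map_uniformOfFinset_mul]
          calc _ ≤ ((free X h).card : ℝ≥0∞)⁻¹ * ((free X h).card * (Φ h + c)) := by
                gcongr
                exact h₁ h hf
            _ = _ := by
                rw [← mul_assoc, ENNReal.inv_mul_cancel, one_mul]
                · simpa using hf.ne_empty
                · exact ENNReal.natCast_ne_top _
        · simp only [hf, dite_false]
          rw [tsum_pure_mul]
          exact h₂ h hf
    _ = _ := by
        simp only [mul_add]
        rw [ENNReal.tsum_add, ENNReal.tsum_mul_right, PMF.tsum_coe, one_mul]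

/-- Summing the one-round drifts gives a supermartingale bound with an additive error. -/
theorem tsum_randomPlay_le (τ : BreakerStrategy X b) (Φ : ℕ → History α → ℝ≥0∞) (c : ℕ → ℝ≥0∞)
    (h₁ : ∀ k h, (free X h).Nonempty →
      ∑ e ∈ free X h, Φ (k + 1) ((e, τ.move h e) :: h) ≤ (free X h).card * (Φ k h + c k))
    (h₂ : ∀ k h, ¬ (free X h).Nonempty → Φ (k + 1) h ≤ Φ k h + c k) (k : ℕ) :
    ∑' h, randomPlay τ k h * Φ k h ≤ Φ 0 [] + ∑ i ∈ Finset.range k, c i := by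
  induction k with
  | zero => simp [randomPlay]
  | succ k ih =>
    rw [Finset.sum_range_succ, ← add_assoc]
    exact (randomPlay_step τ k (Φ k) (Φ (k + 1)) (c k) (h₁ k) (h₂ k)).trans (by gcongr)

theorem toOuterMeasure_le_tsum_mul {β : Type*} (p : PMF β) (A : Set β) (Φ : β → ℝ≥0∞)
    (h : ∀ a ∈ A, 1 ≤ Φ a) : p.toOuterMeasure A ≤ ∑' a, p a * Φ a := by
  rw [PMF.toOuterMeasure_apply]
  refine ENNReal.tsum_le_tsum fun a => ?_
  by_cases ha : a ∈ A
  · rw [Set.indicator_of_mem ha]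
    exact le_mul_of_one_le_right' (h a ha)
  · rw [Set.indicator_of_notMem ha]
    exact zero_le

end Expectation

/-! ### The quadratic potential against a random Maker -/

section Potential

theorem card_insideEdges_le {V : Type*} [DecidableEq V] (S : Finset V) (F : Finset (Sym2 V)) :
    (insideEdges S F).card ≤ S.card * S.card := by
  have hsub : insideEdges S F ⊆ (S ×ˢ S).image fun p => s(p.1, p.2) := by
    intro e he
    induction e using Sym2.ind with
    | _ x y =>
      simp only [insideEdges, Finset.mem_filter] at he
      exact Finset.mem_image.2 ⟨(x, y), Finset.mem_product.2
        ⟨he.2 x (Sym2.mem_mk_left _ _), he.2 y (Sym2.mem_mk_right _ _)⟩, rfl⟩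
  exact (Finset.card_le_card hsub).trans (Finset.card_image_le.trans
    (Finset.card_product _ _).le)

theorem dangerousEdges_subset {V : Type*} [DecidableEq V] (S : Finset V)
    (M F : Finset (Sym2 V)) : dangerousEdges S M F ⊆ insideEdges S F := by
  intro f hf
  simp only [dangerousEdges, insideEdges, Finset.mem_filter] at hf ⊢
  exact ⟨hf.1, hf.2.1⟩

open Classical in
theorem card_filter_meets_le {V : Type*} [Fintype V] (S : Finset V) (F : Finset (Sym2 V)) :
    (F.filter fun e => ∃ v ∈ e, v ∈ S).card ≤ S.card * Fintype.card V := by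
  have hsub : (F.filter fun e => ∃ v ∈ e, v ∈ S) ⊆
      (S ×ˢ (Finset.univ : Finset V)).image fun p => s(p.1, p.2) := by
    intro e he
    obtain ⟨_, v, hv, hS⟩ := Finset.mem_filter.1 he
    obtain ⟨w, rfl⟩ := Sym2.mem_iff_exists.1 hv
    exact Finset.mem_image.2 ⟨(v, w), Finset.mem_product.2 ⟨hS, Finset.mem_univ _⟩, rfl⟩
  exact (Finset.card_le_card hsub).trans (Finset.card_image_le.trans
    (Finset.card_product _ _).le)

/-- The histories of `k` rounds in which Maker has not claimed a dangerous edge. -/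
structure SafeHistory {n : ℕ} (S : Finset (Fin n)) (m b k : ℕ) (h : History (Sym2 (Fin n))) :
    Prop where
  star : StarPosition S (makerSet h) (free (board n) h)
  inside : (insideEdges S (free (board n) h)).card ≤ S.card * S.card - k * m
  card_free : (board n).card ≤ (free (board n) h).card + k * (b + 1)

/-- The number of dangerous edges. -/
noncomputable def danger {n : ℕ} (S : Finset (Fin n)) (h : History (Sym2 (Fin n))) : ℕ :=
  (dangerousEdges S (makerSet h) (free (board n) h)).card

open Classical in
/-- An upper bound for the probability that Maker claims a dangerous edge later on, up to an
error which depends on the number of remaining rounds. -/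
noncomputable def potential {n : ℕ} (S : Finset (Fin n)) (m b k : ℕ)
    (h : History (Sym2 (Fin n))) : ℝ :=
  if SafeHistory S m b k h then min 1 ((danger S h : ℝ) ^ 2 / (4000 * (m : ℝ) ^ 3)) else 1

theorem potential_le_one {n : ℕ} (S : Finset (Fin n)) (m b k : ℕ)
    (h : History (Sym2 (Fin n))) : potential S m b k h ≤ 1 := by
  unfold potential
  split_ifs
  · exact min_le_left _ _
  · exact le_rfl

theorem potential_nonneg {n : ℕ} (S : Finset (Fin n)) (m b k : ℕ)
    (h : History (Sym2 (Fin n))) : 0 ≤ potential S m b k h := by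
  unfold potential
  split_ifs
  · positivity
  · exact zero_le_one

theorem SafeHistory.potential_le {n : ℕ} {S : Finset (Fin n)} {m b k : ℕ}
    {h : History (Sym2 (Fin n))} (hs : SafeHistory S m b k h) :
    potential S m b k h ≤ (danger S h : ℝ) ^ 2 / (4000 * (m : ℝ) ^ 3) := by
  rw [potential, if_pos hs]
  exact min_le_right _ _

/-- At most `|S|²` edges lie inside `S` and each round removes at least `m` while any remain. With
`|S| = 2 m` the danger is over after `4 m` rounds. -/
theorem SafeHistory.danger_eq_zero {n : ℕ} {S : Finset (Fin n)} {m b k : ℕ}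
    {h : History (Sym2 (Fin n))} (hs : SafeHistory S m b k h) (hk : S.card * S.card ≤ k * m) :
    danger S h = 0 := by
  have h1 := Finset.card_le_card (dangerousEdges_subset S (makerSet h) (free (board n) h))
  have h2 := hs.inside
  have h3 : danger S h ≤ (insideEdges S (free (board n) h)).card := h1
  omega

theorem SafeHistory.cons {n b m k : ℕ} {S : Finset (Fin n)} (τ : BreakerStrategy (board n) b)
    {h : History (Sym2 (Fin n))} (hs : SafeHistory S m b k h) {e : Sym2 (Fin n)}
    (he : e ∈ free (board n) h)
    (hstar : StarPosition S (makerSet ((e, τ.move h e) :: h))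
      (free (board n) ((e, τ.move h e) :: h)))
    (hin : (insideEdges S (free (board n) ((e, τ.move h e) :: h))).card ≤
        (insideEdges S (free (board n) h)).card - m) :
    SafeHistory S m b (k + 1) ((e, τ.move h e) :: h) := by
  refine ⟨hstar, ?_, ?_⟩
  · have := hs.inside
    rw [add_mul, one_mul]
    omega
  · have h1 := hs.card_free
    have h2 := τ.card_move h e he
    have h3 := Finset.le_card_sdiff (τ.move h e) ((free (board n) h).erase e)
    have h4 := Finset.card_erase_of_mem he
    have h5 : (free (board n) ((e, τ.move h e) :: h)).card =
      ((free (board n) h).erase e \ τ.move h e).card := by rw [free_cons]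
    rw [add_mul, one_mul]
    omega

theorem card_board (n : ℕ) : (board n).card = n.choose 2 := by
  rw [board, SimpleGraph.card_edgeFinset_top_eq_card_choose_two, Fintype.card_fin]

/-- The real inequality behind the drift of the potential. -/
theorem drift_inequality {N D m t : ℝ} (hm : 1 ≤ m) (hD : 0 ≤ D) (hN : 4000 * m ^ 2 ≤ N)
    (ht : t ≤ 200 * m ^ 2) :
    D + (N * ((D - m) ^ 2 / (4000 * m ^ 3)) + t * ((8 * D * m + 8 * m ^ 2) / (4000 * m ^ 3))) ≤
      N * (D ^ 2 / (4000 * m ^ 3) + 1 / (2000 * m)) := by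
  have hm0 : 0 < m := by linarith
  have h1 : t * ((8 * D * m + 8 * m ^ 2) / (4000 * m ^ 3)) ≤
      200 * m ^ 2 * ((8 * D * m + 8 * m ^ 2) / (4000 * m ^ 3)) := by gcongr
  have h2 : 200 * m ^ 2 * ((8 * D * m + 8 * m ^ 2) / (4000 * m ^ 3)) = (2 * D + 2 * m) / 5 := by
    field_simp
    ring
  have h3 : N * (D ^ 2 / (4000 * m ^ 3) + 1 / (2000 * m)) -
      N * ((D - m) ^ 2 / (4000 * m ^ 3)) = N * ((2 * D + m) / (4000 * m ^ 2)) := by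
    field_simp
    ring
  have h4 : 4000 * m ^ 2 * ((2 * D + m) / (4000 * m ^ 2)) ≤
      N * ((2 * D + m) / (4000 * m ^ 2)) := by gcongr
  have h5 : 4000 * m ^ 2 * ((2 * D + m) / (4000 * m ^ 2)) = 2 * D + m := by
    field_simp
  -- After clearing `N`, the loss on the left is `D + (2 D + 2 m) / 5`, and the gain on the right is
  -- at least `2 D + m`.
  linarith

/-- The one-round drift. In the first `4 m` rounds at least `4000 m²` edges are free and at most
`200 m²` of them meet `S`, so the steady removal of `m` dangerous edges outweighs both the chance of
hitting one and the rare creation of new ones. Later the potential of a safe history stays zero. -/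
theorem sum_potential_le {n b m k : ℕ} (hm : 1 ≤ m) (hn : n = 100 * m) (hb : b ≤ n)
    {S : Finset (Fin n)} (hS : S.card = 2 * m) (τ : BreakerStrategy (board n) b)
    (hτ : ∀ h, ∀ e ∈ free (board n) h,
      StarPosition S (makerSet h) (free (board n) h) →
      e ∉ dangerousEdges S (makerSet h) (free (board n) h) →
      StarPosition S (makerSet ((e, τ.move h e) :: h)) (free (board n) ((e, τ.move h e) :: h)) ∧
      (insideEdges S (free (board n) ((e, τ.move h e) :: h))).card ≤
        (insideEdges S (free (board n) h)).card - m ∧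
      (dangerousEdges S (makerSet ((e, τ.move h e) :: h))
          (free (board n) ((e, τ.move h e) :: h))).card ≤
        (dangerousEdges S (makerSet h) (free (board n) h)).card + dangerIncrement S e - m)
    (h : History (Sym2 (Fin n))) :
    ∑ e ∈ free (board n) h, potential S m b (k + 1) ((e, τ.move h e) :: h) ≤
      (free (board n) h).card * (potential S m b k h + if k < 4 * m then 1 / (2000 * (m : ℝ)) else 0) := by
  classical
  have hc0 : (0 : ℝ) ≤ if k < 4 * m then 1 / (2000 * (m : ℝ)) else 0 := by split_ifs <;> positivity
  have htriv : potential S m b k h = 1 →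
      ∑ e ∈ free (board n) h, potential S m b (k + 1) ((e, τ.move h e) :: h) ≤
      (free (board n) h).card *
        (potential S m b k h + if k < 4 * m then 1 / (2000 * (m : ℝ)) else 0) := by
    intro h1
    calc _ ≤ ∑ e ∈ free (board n) h, (1 : ℝ) :=
          Finset.sum_le_sum fun e _ => potential_le_one _ _ _ _ _
      _ = (free (board n) h).card * 1 := by simp
      _ ≤ _ := by rw [h1]; gcongr; linarith
  by_cases hs : SafeHistory S m b k h
  swap
  · exact htriv (if_neg hs)
  by_cases hk : k < 4 * m
  swap
  · have hz : potential S m b k h = 0 ∨ 0 ≤ potential S m b k h :=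
      Or.inr (potential_nonneg _ _ _ _ _)
    have hkm : S.card * S.card ≤ k * m := by
      rw [hS]; push Not at hk; nlinarith
    have hd0 := hs.danger_eq_zero hkm
    have hle : ∀ e ∈ free (board n) h, potential S m b (k + 1) ((e, τ.move h e) :: h) ≤ 0 := by
      intro e he
      have hed : e ∉ dangerousEdges S (makerSet h) (free (board n) h) := by
        rw [danger, Finset.card_eq_zero] at hd0
        rw [hd0]; simp
      obtain ⟨h1, h2, _⟩ := hτ h e he hs.star hed
      have hs' := hs.cons τ he h1 h2
      refine hs'.potential_le.trans ?_
      rw [hs'.danger_eq_zero (by nlinarith)]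
      simp
    exact (Finset.sum_nonpos hle).trans (mul_nonneg (Nat.cast_nonneg _)
      (add_nonneg (potential_nonneg _ _ _ _ _) hc0))
  by_cases hbig : 1 ≤ (danger S h : ℝ) ^ 2 / (4000 * (m : ℝ) ^ 3)
  · exact htriv (by rw [potential, if_pos hs, min_eq_left hbig])
  have hpot : potential S m b k h = (danger S h : ℝ) ^ 2 / (4000 * (m : ℝ) ^ 3) := by
    rw [potential, if_pos hs, min_eq_right (by linarith)]
  rw [hpot, if_pos hk]
  set F := free (board n) h with hF
  set D : ℝ := (danger S h : ℝ) with hD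
  have hm' : (1 : ℝ) ≤ m := by exact_mod_cast hm
  have hm0 : (0 : ℝ) < m := by linarith
  have hD0 : 0 ≤ D := Nat.cast_nonneg _
  -- A dangerous move costs at most 1. Otherwise `D` falls by `m`, except that a move meeting `S`
  -- may raise it by `4 m - m`. The correction term is `(D + 3 m)² - (D - m)²`.
  have hterm : ∀ e ∈ F, potential S m b (k + 1) ((e, τ.move h e) :: h) ≤
      (if e ∈ dangerousEdges S (makerSet h) F then 1 else 0) +
      ((D - m) ^ 2 / (4000 * (m : ℝ) ^ 3) +
        if ∃ v ∈ e, v ∈ S then (8 * D * m + 8 * (m : ℝ) ^ 2) / (4000 * (m : ℝ) ^ 3) else 0) := by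
    intro e he
    by_cases hed : e ∈ dangerousEdges S (makerSet h) F
    · rw [if_pos hed]
      refine (potential_le_one _ _ _ _ _).trans ?_
      have : (0 : ℝ) ≤ (D - m) ^ 2 / (4000 * (m : ℝ) ^ 3) := by positivity
      have : (0 : ℝ) ≤ if ∃ v ∈ e, v ∈ S then
          (8 * D * m + 8 * (m : ℝ) ^ 2) / (4000 * (m : ℝ) ^ 3) else 0 := by
        split_ifs <;> positivity
      linarith
    · rw [if_neg hed, zero_add]
      obtain ⟨h1, h2, h3⟩ := hτ h e he hs.star hed
      have hs' := hs.cons τ he h1 h2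
      refine hs'.potential_le.trans ?_
      have h4 : danger S ((e, τ.move h e) :: h) ≤ danger S h + dangerIncrement S e - m := h3
      by_cases ht : ∃ v ∈ e, v ∈ S
      · rw [if_pos ht, ← add_div]
        rw [dangerIncrement, if_pos ht, hS] at h4
        have h5 : (danger S ((e, τ.move h e) :: h) : ℝ) ≤ D + 3 * m := by
          have : danger S ((e, τ.move h e) :: h) ≤ danger S h + 3 * m := by omega
          rw [hD]
          exact_mod_cast this
        have h6 : (D - m) ^ 2 + (8 * D * m + 8 * (m : ℝ) ^ 2) = (D + 3 * m) ^ 2 := by ring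
        rw [h6]
        gcongr
      · rw [if_neg ht, add_zero]
        rw [dangerIncrement, if_neg ht, add_zero] at h4
        refine div_le_div_of_nonneg_right ?_ (by positivity)
        rcases le_total m (danger S h) with hmd | hmd
        · have h5 : (danger S ((e, τ.move h e) :: h) : ℝ) ≤ D - m := by
            rw [hD, ← Nat.cast_sub hmd]
            exact_mod_cast h4
          gcongr
        · have h5 : danger S ((e, τ.move h e) :: h) = 0 := by omega
          rw [h5]
          simpa using sq_nonneg (D - m)
  refine (Finset.sum_le_sum hterm).trans ?_
  rw [Finset.sum_add_distrib, Finset.sum_add_distrib, ← Finset.sum_filter, ← Finset.sum_filter]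
  simp only [Finset.sum_const, nsmul_eq_mul, mul_one]
  have hfd : F.filter (fun e => e ∈ dangerousEdges S (makerSet h) F) =
      dangerousEdges S (makerSet h) F := by
    rw [Finset.filter_mem_eq_inter]
    exact Finset.inter_eq_right.2
      ((dangerousEdges_subset S _ _).trans (insideEdges_subset S _))
  rw [hfd]
  refine drift_inequality hm' hD0 ?_ ?_
  · have h1 := hs.card_free
    rw [card_board, Nat.choose_two_right] at h1
    have h3 : n * (n - 1) = 2 * (50 * m * (100 * m - 1)) := by rw [hn]; ring
    rw [h3, Nat.mul_div_cancel_left _ (by norm_num)] at h1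
    -- About `5000 m²` edges on the board, less about `400 m²` claimed so far, leave at least `4000
    -- m²`.
    have h4 : k * (b + 1) ≤ 4 * m * (100 * m + 1) := by
      gcongr; omega
    have h5 : 4000 * m ^ 2 ≤ F.card := by
      obtain ⟨q, rfl⟩ : ∃ q, m = q + 1 := ⟨m - 1, by omega⟩
      have h6 : 100 * (q + 1) - 1 = 100 * q + 99 := by omega
      rw [h6] at h1
      nlinarith
    exact_mod_cast h5
  · have h1 := card_filter_meets_le S F
    rw [hS, Fintype.card_fin] at h1
    have h2 : 2 * m * n = 200 * m ^ 2 := by rw [hn]; ring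
    rw [h2] at h1
    refine le_trans (le_of_eq ?_) (Nat.cast_le.2 h1 |>.trans (by push_cast; exact le_rfl))
    congr!

theorem potential_succ_le {n b m k : ℕ} {S : Finset (Fin n)} (h : History (Sym2 (Fin n)))
    (hf : ¬ (free (board n) h).Nonempty) : potential S m b (k + 1) h ≤ potential S m b k h := by
  by_cases hs : SafeHistory S m b k h
  · have he : free (board n) h = ∅ := Finset.not_nonempty_iff_eq_empty.1 hf
    have hs' : SafeHistory S m b (k + 1) h := by
      refine ⟨hs.star, ?_, hs.card_free.trans ?_⟩
      · rw [he]; simp [insideEdges]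
      · gcongr; omega
    rw [potential, potential, if_pos hs, if_pos hs']
  · rw [potential.eq_def S m b k, if_neg hs]
    exact potential_le_one _ _ _ _ _

theorem potential_nil {n b m : ℕ} (S : Finset (Fin n)) : potential S m b 0 [] = 0 := by
  have hs : SafeHistory S m b 0 ([] : History (Sym2 (Fin n))) := by
    refine ⟨starPosition_nil n S, ?_, by simp [free]⟩
    simpa using card_insideEdges_le S _
  have hd : danger S ([] : History (Sym2 (Fin n))) = 0 := by
    simp [danger, dangerousEdges]
  rw [potential, if_pos hs, hd]
  simp

/-- RandomMaker loses with probability bounded away from zero. -/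
theorem graphProbRC_le {W : Type*} {H : SimpleGraph W}
    (hH : (SimpleGraph.pathGraph 11).IsContained H) {m b : ℕ} (hm : 1 ≤ m)
    (hb : 99 * m ≤ b) (hb' : b ≤ 100 * m) :
    graphProbRC (containsSubgraph H) (100 * m) b ≤ 1 / 2 := by
  obtain ⟨n, hn⟩ : ∃ n, n = 100 * m := ⟨_, rfl⟩
  rw [← hn] at hb' ⊢
  obtain ⟨S, -, hS⟩ := Finset.exists_subset_card_eq (s := (Finset.univ : Finset (Fin n)))
    (n := 2 * m) (by simp; omega)
  obtain ⟨τ, hτ⟩ := exists_starStrategy n b m S (by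
    rw [Finset.card_compl, hS, Fintype.card_fin]; omega)
  rw [graphProbRC, probRC]
  refine (iInf_le _ τ).trans ?_
  set c : ℕ → ℝ := fun k => if k < 4 * m then 1 / (2000 * (m : ℝ)) else 0 with hc
  have hc0 : ∀ k, 0 ≤ c k := fun k => by rw [hc]; dsimp only; split_ifs <;> positivity
  have hsum : ∀ K, ∑ i ∈ Finset.range K, c i ≤ 1 / 2 := by
    intro K
    rw [hc, ← Finset.sum_filter, Finset.sum_const, nsmul_eq_mul]
    have h1 : ((Finset.range K).filter fun k => k < 4 * m).card ≤ 4 * m := by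
      refine (Finset.card_le_card (t := Finset.range (4 * m)) ?_).trans (Finset.card_range _).le
      intro i hi
      exact Finset.mem_range.2 (Finset.mem_filter.1 hi).2
    have hm0 : (0 : ℝ) < m := by exact_mod_cast hm
    calc _ ≤ ((4 * m : ℕ) : ℝ) * (1 / (2000 * m)) := by gcongr
      _ = 1 / 500 := by push_cast; field_simp; norm_num
      _ ≤ _ := by norm_num
  have h1 := tsum_randomPlay_le τ (fun k h => ENNReal.ofReal (potential S m b k h))
    (fun k => ENNReal.ofReal (c k)) ?_ ?_ (board n).card
  · refine (toOuterMeasure_le_tsum_mul _ _ _ ?_).trans (h1.trans ?_)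
    · intro h hw
      have hs : ¬ SafeHistory S m b (board n).card h := fun hs =>
        not_containsSubgraph_of_starPosition hH hs.star hw
      rw [potential, if_neg hs]
      simp
    · rw [potential_nil, ENNReal.ofReal_zero, zero_add,
        ← ENNReal.ofReal_sum_of_nonneg fun i _ => hc0 i]
      refine (ENNReal.ofReal_le_ofReal (hsum _)).trans ?_
      rw [ENNReal.ofReal_div_of_pos (by norm_num)]
      simp
  · intro k h hf
    rw [← ENNReal.ofReal_sum_of_nonneg fun e _ => potential_nonneg _ _ _ _ _,
      ← ENNReal.ofReal_add (potential_nonneg _ _ _ _ _) (hc0 k), ← ENNReal.ofReal_natCast,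
      ← ENNReal.ofReal_mul (Nat.cast_nonneg _)]
    exact ENNReal.ofReal_le_ofReal (sum_potential_le hm hn hb' hS τ hτ h)
  · intro k h hf
    rw [← ENNReal.ofReal_add (potential_nonneg _ _ _ _ _) (hc0 k)]
    exact ENNReal.ofReal_le_ofReal ((potential_succ_le h hf).trans (le_add_of_nonneg_right (hc0 k)))

end Potential

/-! ### From forcing a position to a winning strategy -/

section Forcing

variable {α : Type*} [DecidableEq α]

/-- From the position with claimed sets `M` and `B`, Maker can reach `P` in exactly `k` rounds. -/
def CanForce (X : Finset α) (b : ℕ) (P : Finset α → Finset α → Prop) :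
    ℕ → Finset α → Finset α → Prop
  | 0, M, B => P M B
  | k + 1, M, B => ∃ e ∈ X \ (M ∪ B), ∀ Q ⊆ (X \ (M ∪ B)).erase e, Q.card ≤ b →
      CanForce X b P k (insert e M) (Q ∪ B)

variable {X : Finset α} {b : ℕ}

theorem CanForce.trans {P P' : Finset α → Finset α → Prop} {l : ℕ}
    (hP : ∀ M B, P M B → CanForce X b P' l M B) {k : ℕ} {M B : Finset α}
    (h : CanForce X b P k M B) : CanForce X b P' (k + l) M B := by
  induction k generalizing M B with
  | zero => rw [Nat.zero_add]; exact hP M B h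
  | succ k ih =>
    obtain ⟨e, he, hQ⟩ := h
    rw [Nat.succ_add]
    exact ⟨e, he, fun Q h1 h2 => ih (hQ Q h1 h2)⟩

theorem CanForce.mono {P P' : Finset α → Finset α → Prop}
    (hP : ∀ M B, P M B → P' M B) {k : ℕ} {M B : Finset α}
    (h : CanForce X b P k M B) : CanForce X b P' k M B :=
  h.trans (l := 0) hP

/-- Maker reads the number of remaining forcing rounds off the length of the history and plays a
witness of `CanForce`; afterwards any moves do, as his set only grows. -/
theorem CanForce.makerHasWinningStrategy {P : Finset α → Finset α → Prop} {K : ℕ}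
    (h : CanForce X b P K ∅ ∅) {Win : Finset α → Prop}
    (hP : ∀ M B, P M B → ∀ M', M ⊆ M' → Win M') : MakerHasWinningStrategy X b Win := by
  classical
  let Good : History α → α → Prop := fun g e => e ∈ free X g ∧
    ∀ Q ⊆ (free X g).erase e, Q.card ≤ b →
      CanForce X b P (K - (g.length + 1)) (insert e (makerSet g)) (Q ∪ breakerSet g)
  let σ : MakerStrategy X :=
    { move := fun g hf => if hg : ∃ e, Good g e then hg.choose else hf.choose
      legal := fun g hf => by
        by_cases hg : ∃ e, Good g e
        · simp only [hg, dite_true]; exact hg.choose_spec.1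
        · simp only [hg, dite_false]; exact hf.choose_spec }
  refine ⟨σ, fun τ => ?_⟩
  have key : ∀ t ≤ K, (play σ τ t).length = t ∧
      CanForce X b P (K - t) (makerSet (play σ τ t)) (breakerSet (play σ τ t)) ∧
      makerSet (play σ τ t) ⊆ X ∧ (makerSet (play σ τ t)).card = t := by
    intro t
    induction t with
    | zero => intro _; exact ⟨rfl, h, by simp [play], by simp [play]⟩
    | succ t ih =>
      intro ht
      obtain ⟨h1, h2, h3, h4⟩ := ih (by omega)
      set g := play σ τ t with hg
      rw [show K - t = K - (t + 1) + 1 by omega] at h2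
      obtain ⟨e, he, hQ⟩ := h2
      have hf : (free X g).Nonempty := ⟨e, he⟩
      have hgood : ∃ e, Good g e := ⟨e, he, by rw [h1]; exact hQ⟩
      have hmove : Good g (σ.move g hf) := by
        change Good g (if hg : ∃ e, Good g e then hg.choose else hf.choose)
        rw [dif_pos hgood]
        exact hgood.choose_spec
      have hplay : play σ τ (t + 1) = (σ.move g hf, τ.move g (σ.move g hf)) :: g := by
        rw [play]
        simp only [← hg, hf, dite_true]
      have hfree := hmove.1
      rw [hplay]
      refine ⟨by simp [h1], ?_, ?_, ?_⟩
      · have := hmove.2 (τ.move g (σ.move g hf)) (τ.subset_free g _ hfree)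
          (by rw [τ.card_move g _ hfree]; exact min_le_left _ _)
        rw [h1] at this
        simpa using this
      · rw [makerSet_cons]
        exact Finset.insert_subset (Finset.mem_sdiff.1 hfree).1 h3
      · rw [makerSet_cons, Finset.card_insert_of_notMem, h4]
        exact fun hm => (Finset.mem_sdiff.1 hfree).2 (Finset.mem_union_left _ hm)
  obtain ⟨-, h2, h3, h4⟩ := key K le_rfl
  -- Maker has claimed `K` distinct elements, so the forcing phase fits into the `X.card` rounds of
  -- the game.
  have hKX : K ≤ X.card := h4 ▸ Finset.card_le_card h3
  have hmono : ∀ t, K ≤ t → makerSet (play σ τ K) ⊆ makerSet (play σ τ t) := by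
    intro t ht
    induction t, ht using Nat.le_induction with
    | base => exact subset_rfl
    | succ t _ ih =>
      rw [play.eq_def σ τ (t + 1)]
      by_cases hf : (free X (play σ τ t)).Nonempty
      · simp only [hf, dite_true, makerSet_cons]
        exact ih.trans (Finset.subset_insert _ _)
      · simp only [hf, dite_false]
        exact ih
  rw [Nat.sub_self] at h2
  exact hP _ _ h2 _ (hmono _ hKX)

end Forcing

/-! ### Counting Breaker's degrees -/

section Degree

variable {V : Type*} [Fintype V] [DecidableEq V]

/-- The number of vertices joined to `v` by an edge of `B`. -/
def edgeDegree (B : Finset (Sym2 V)) (v : V) : ℕ :=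
  (Finset.univ.filter fun w => s(v, w) ∈ B).card

theorem edgeDegree_union_le (A B : Finset (Sym2 V)) (v : V) :
    edgeDegree (A ∪ B) v ≤ A.card + edgeDegree B v := by
  have hsub : (Finset.univ.filter fun w => s(v, w) ∈ A ∪ B) ⊆
      (Finset.univ.filter fun w => s(v, w) ∈ A) ∪ Finset.univ.filter fun w => s(v, w) ∈ B := by
    intro w hw
    simpa using hw
  have hA : (Finset.univ.filter fun w => s(v, w) ∈ A).card ≤ A.card := by
    refine Finset.card_le_card_of_injOn (fun w => s(v, w)) ?_ ?_
    · intro w hw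
      simpa using hw
    · intro w _ w' _ hww
      exact Sym2.congr_right.1 hww
  have := Finset.card_le_card hsub
  have := Finset.card_union_le (Finset.univ.filter fun w => s(v, w) ∈ A)
    (Finset.univ.filter fun w => s(v, w) ∈ B)
  unfold edgeDegree
  omega

theorem sum_edgeDegree (B : Finset (Sym2 V)) (U : Finset V) :
    ∑ v ∈ U, edgeDegree B v =
      ((U ×ˢ (Finset.univ : Finset V)).filter fun p => s(p.1, p.2) ∈ B).card := by
  rw [Finset.card_filter, Finset.sum_product]
  refine Finset.sum_congr rfl fun v _ => ?_
  rw [edgeDegree, Finset.card_filter]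

theorem sum_edgeDegree_le_two_mul (B : Finset (Sym2 V)) (U : Finset V) :
    ∑ v ∈ U, edgeDegree B v ≤ 2 * B.card := by
  rw [sum_edgeDegree]
  refine Finset.card_le_mul_card_image_of_maps_to (f := fun p : V × V => s(p.1, p.2))
    (fun p hp => (Finset.mem_filter.1 hp).2) 2 fun e _ => ?_
  induction e using Sym2.ind with
  | _ x y =>
    refine (Finset.card_le_card (t := {(x, y), (y, x)}) ?_).trans Finset.card_le_two
    rintro ⟨a, c⟩ hp
    have h1 := (Finset.mem_filter.1 hp).2
    rw [Sym2.eq_iff] at h1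
    simpa using h1

/-- Only edges with both ends in `U` are counted twice. For bounded `U` this saves the factor 2 of
the handshake bound, which would be too weak for biases near `n`. -/
theorem sum_edgeDegree_le_add_sq (B : Finset (Sym2 V)) (U : Finset V) :
    ∑ v ∈ U, edgeDegree B v ≤ B.card + U.card ^ 2 := by
  rw [sum_edgeDegree]
  set A := (U ×ˢ (Finset.univ : Finset V)).filter fun p => s(p.1, p.2) ∈ B with hA
  rw [← Finset.card_filter_add_card_filter_not (s := A) (fun p => p.2 ∉ U)]
  gcongr
  · refine Finset.card_le_card_of_injOn (fun p => s(p.1, p.2)) ?_ ?_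
    · intro p hp
      simp only [hA, Finset.coe_filter, Finset.mem_filter, Set.mem_ofPred_eq] at hp
      exact hp.1.2
    · rintro ⟨a, c⟩ hp ⟨a', c'⟩ hp' heq
      simp only [hA, Finset.coe_filter, Finset.mem_filter, Set.mem_ofPred_eq,
        Finset.mem_product] at hp hp'
      rcases Sym2.eq_iff.1 heq with ⟨rfl, rfl⟩ | ⟨rfl, rfl⟩
      · rfl
      · exact absurd hp'.1.1.1 hp.2
  · rw [sq, ← Finset.card_product]
    refine Finset.card_le_card fun p hp => ?_
    simp only [hA, Finset.mem_filter, Finset.mem_product, not_not] at hp ⊢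
    exact ⟨hp.1.1.1, hp.2⟩

/-- There is a new vertex of low degree which is not joined to `v`. -/
theorem exists_fresh_vertex (B : Finset (Sym2 V)) (U : Finset V) (v : V) {d δ u β : ℕ}
    (hv : edgeDegree B v ≤ d) (hU : U.card ≤ u) (hB : B.card ≤ β)
    (hn : ∀ h, h * (δ + 1) ≤ 2 * β → d + u + h < Fintype.card V) :
    ∃ w ∉ U, s(v, w) ∉ B ∧ edgeDegree B w ≤ δ := by
  -- The size of `T`, the set of high-degree vertices, is the value of `h` fed to `hn`.
  set T := Finset.univ.filter fun w => δ + 1 ≤ edgeDegree B w with hT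
  have hTc : T.card * (δ + 1) ≤ 2 * β := by
    calc T.card * (δ + 1) = ∑ w ∈ T, (δ + 1) := by rw [Finset.sum_const, smul_eq_mul]
      _ ≤ ∑ w ∈ T, edgeDegree B w := Finset.sum_le_sum fun w hw => (Finset.mem_filter.1 hw).2
      _ ≤ _ := (sum_edgeDegree_le_two_mul B T).trans (by omega)
  have hlt := hn _ hTc
  have h1 := Finset.card_union_le ((Finset.univ.filter fun w => s(v, w) ∈ B) ∪ U) T
  have h2 := Finset.card_union_le (Finset.univ.filter fun w => s(v, w) ∈ B) U
  have h3 : (Finset.univ.filter fun w => s(v, w) ∈ B).card ≤ d := hv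
  obtain ⟨w, hw⟩ : ∃ w, w ∉ ((Finset.univ.filter fun w => s(v, w) ∈ B) ∪ U) ∪ T := by
    by_contra hall
    push Not at hall
    have := Finset.card_le_card (s := Finset.univ) fun w _ => hall w
    rw [Finset.card_univ] at this
    omega
  simp only [hT, Finset.mem_union, Finset.mem_filter, Finset.mem_univ, true_and, not_or] at hw
  exact ⟨w, hw.1.2, hw.1.1, by omega⟩

end Degree

/-! ### Maker's path extensions and the spiders they form -/

section Maker

variable {n : ℕ}

/-- Maker's graph `M'` extends `M` by a path of length `L` which starts at `v` and otherwise
avoids `U`. -/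
structure PathExtension (U : Finset (Fin n)) (M M' : Finset (Sym2 (Fin n))) (v : Fin n) (L : ℕ)
    (q : ℕ → Fin n) : Prop where
  zero : q 0 = v
  edge : ∀ i < L, s(q i, q (i + 1)) ∈ M'
  inj : ∀ i ≤ L, ∀ j ≤ L, q i = q j → i = j
  avoid : ∀ i < L, q (i + 1) ∉ U
  subset : M ⊆ M'
  inside : ∀ e ∈ M', ∀ x ∈ e, x ∈ U ∨ ∃ i ≤ L, x = q i

/-- Maker can extend a path step by step from an endpoint of small Breaker degree. -/
theorem canForce_pathExtension {b δ u β : ℕ}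
    (hn : ∀ h, h * (δ + 1) ≤ 2 * β → b + δ + u + h < n) (L : ℕ) :
    ∀ (U : Finset (Fin n)) (v : Fin n) (M B : Finset (Sym2 (Fin n))), v ∈ U →
      (∀ e ∈ M, ∀ x ∈ e, x ∈ U) → edgeDegree B v ≤ b + δ → U.card + L ≤ u →
      B.card + L * b ≤ β →
      CanForce (board n) b
        (fun M' B' => (∃ q, PathExtension U M M' v L q) ∧ B'.card ≤ B.card + L * b) L M B := by
  induction L with
  | zero =>
    intro U v M B hv hM _ _ _
    refine ⟨⟨fun _ => v, rfl, by simp, by omega, by simp, subset_rfl,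
      fun e he x hx => Or.inl (hM e he x hx)⟩, by simp⟩
  | succ L ih =>
    intro U v M B hv hM hd hU hB
    rw [add_mul, one_mul] at hB
    obtain ⟨w, hwU, hwB, hwd⟩ := exists_fresh_vertex B U v hd (show U.card ≤ u by omega)
      (show B.card ≤ β by omega) (by simpa using hn)
    have hvw : v ≠ w := by rintro rfl; exact hwU hv
    refine ⟨s(v, w), ?_, fun Q hQ hQb => ?_⟩
    · rw [Finset.mem_sdiff, mem_board, Finset.mem_union, not_or]
      exact ⟨hvw, fun hm => hwU (hM _ hm w (Sym2.mem_mk_right _ _)), hwB⟩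
    · have hQB := Finset.card_union_le Q B
      -- The new endpoint had Breaker degree at most `δ`, so a single reply leaves it at most `b +
      -- δ`, which is the invariant.
      have hdeg := edgeDegree_union_le Q B w
      refine (ih (insert w U) w (insert s(v, w) M) (Q ∪ B) (Finset.mem_insert_self _ _) ?_
        (by omega) ?_ (by omega)).mono ?_
      · intro e he x hx
        rw [Finset.mem_insert] at he ⊢
        rcases he with rfl | he
        · rcases Sym2.mem_iff.1 hx with rfl | rfl
          · exact Or.inr hv
          · exact Or.inl rfl
        · exact Or.inr (hM e he x hx)
      · have := Finset.card_insert_le w U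
        omega
      · rintro M' B' ⟨⟨q, hq⟩, hB'⟩
        refine ⟨⟨fun i => Nat.casesOn i v q, rfl, ?_, ?_, ?_, ?_, ?_⟩, ?_⟩
        · intro i hi
          cases i with
          | zero =>
            change s(v, q 0) ∈ M'
            rw [hq.zero]
            exact hq.subset (Finset.mem_insert_self _ _)
          | succ i => exact hq.edge i (by omega)
        · have hne : ∀ i ≤ L, q i ≠ v := by
            intro i hi hqv
            cases i with
            | zero => exact hvw (by rw [← hqv, hq.zero])
            | succ i =>
              exact hq.avoid i (by omega) (hqv ▸ Finset.mem_insert_of_mem hv)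
          intro i hi j hj hij
          cases i with
          | zero =>
            cases j with
            | zero => rfl
            | succ j => exact absurd hij.symm (hne j (by omega))
          | succ i =>
            cases j with
            | zero => exact absurd hij (hne i (by omega))
            | succ j => rw [hq.inj i (by omega) j (by omega) hij]
        · intro i hi
          change q i ∉ U
          cases i with
          | zero => rw [hq.zero]; exact hwU
          | succ i => exact fun hm => hq.avoid i (by omega) (Finset.mem_insert_of_mem hm)
        · exact (Finset.subset_insert _ _).trans hq.subset
        · intro e he x hx
          rcases hq.inside e he x hx with hx | ⟨i, hi, rfl⟩
          · rcases Finset.mem_insert.1 hx with rfl | hx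
            · exact Or.inr ⟨1, by omega, hq.zero.symm⟩
            · exact Or.inl hx
          · exact Or.inr ⟨i + 1, by omega, rfl⟩
        · rw [add_mul, one_mul]
          omega

theorem containsSubgraph_mono {V : Type*} {H : SimpleGraph V} {M M' : Finset (Sym2 (Fin n))}
    (h : M ⊆ M') (hw : graphWin (containsSubgraph H) n M) :
    graphWin (containsSubgraph H) n M' := by
  refine SimpleGraph.IsContained.trans hw (SimpleGraph.IsContained.of_le ?_)
  exact SimpleGraph.fromEdgeSet_mono (by exact_mod_cast h)

theorem isContained_fromEdgeSet {V : Type*} {r : V → V → Prop} {M : Finset (Sym2 (Fin n))}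
    (f : V → Fin n) (hf : Function.Injective f) (hr : ∀ x y, r x y → s(f x, f y) ∈ M) :
    (SimpleGraph.fromRel r).IsContained (SimpleGraph.fromEdgeSet (M : Set (Sym2 (Fin n)))) := by
  refine ⟨⟨⟨f, ?_⟩, hf⟩⟩
  intro x y hxy
  rw [SimpleGraph.fromRel_adj] at hxy
  rw [SimpleGraph.fromEdgeSet_adj]
  refine ⟨?_, fun h => hxy.1 (hf h)⟩
  rcases hxy.2 with h | h
  · exact_mod_cast hr x y h
  · rw [Sym2.eq_swap]
    exact_mod_cast hr y x h

theorem PathExtension.pathGraph_isContained {U : Finset (Fin n)} {M M' : Finset (Sym2 (Fin n))}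
    {v : Fin n} {L : ℕ} {q : ℕ → Fin n} (h : PathExtension U M M' v L q) :
    (SimpleGraph.pathGraph (L + 1)).IsContained
      (SimpleGraph.fromEdgeSet (M' : Set (Sym2 (Fin n)))) := by
  have hinj : Function.Injective fun i : Fin (L + 1) => q i := fun i j hij =>
    Fin.ext (h.inj i (by omega) j (by omega) hij)
  refine ⟨⟨⟨fun i => q i, ?_⟩, hinj⟩⟩
  intro i j hij
  rw [SimpleGraph.fromEdgeSet_adj]
  refine ⟨?_, fun hh => hij.ne (hinj hh)⟩
  rw [SimpleGraph.pathGraph_adj] at hij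
  rcases hij with hij | hij
  · rw [← hij]
    exact_mod_cast h.edge i (by omega)
  · rw [← hij, Sym2.eq_swap]
    exact_mod_cast h.edge j (by omega)

/-- A path and a further path which starts at one of its inner vertices contain a spider. -/
theorem spider_isContained {M₀ M M' : Finset (Sym2 (Fin n))} {U U' : Finset (Fin n)} {v : Fin n}
    {K j : ℕ} {p q : ℕ → Fin n} (ℓ : Fin 3 → ℕ) (hp : PathExtension U M₀ M v K p)
    (hq : PathExtension U' M M' (p j) (ℓ 2) q) (hU' : ∀ i ≤ K, p i ∈ U')
    (h₀ : j + ℓ 0 ≤ K) (h₁ : ℓ 1 ≤ j) :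
    (spider ℓ).IsContained (SimpleGraph.fromEdgeSet (M' : Set (Sym2 (Fin n)))) := by
  let g : (i : Fin 3) → ℕ → Fin n := fun i t =>
    if i = 0 then p (j + 1 + t) else if i = 1 then p (j - 1 - t) else q (t + 1)
  let f : Option (Σ i : Fin 3, Fin (ℓ i)) → Fin n := fun x =>
    match x with
    | none => p j
    | some ⟨i, t⟩ => g i t
  have hpe : ∀ i < K, s(p i, p (i + 1)) ∈ M' := fun i hi => hq.subset (hp.edge i hi)
  have hg0 : ∀ t, g 0 t = p (j + 1 + t) := fun t => rfl
  have hg1 : ∀ t, g 1 t = p (j - 1 - t) := fun t => rfl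
  have hg2 : ∀ t, g 2 t = q (t + 1) := fun t => rfl
  have hf : Function.Injective f := by
    have hc : ∀ (i : Fin 3) (t : Fin (ℓ i)), g i t ≠ p j := by
      intro i t h
      have ht := t.2
      fin_cases i <;> simp only [Fin.zero_eta, Fin.mk_one, Fin.reduceFinMk, hg0, hg1, hg2] at h ht
      · have := hp.inj _ (by omega) _ (by omega) h
        omega
      · have := hp.inj _ (by omega) _ (by omega) h
        omega
      · exact hq.avoid t ht (h ▸ hU' j (by omega))
    rintro (_ | ⟨i, t⟩) (_ | ⟨i', t'⟩) h
    · rfl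
    · exact absurd h.symm (hc i' t')
    · exact absurd h (hc i t)
    · have ht := t.2
      have ht' := t'.2
      change g i t = g i' t' at h
      have hii : i = i' ∧ (t : ℕ) = t' := by
        fin_cases i <;> fin_cases i' <;> simp only [Fin.zero_eta, Fin.mk_one, Fin.reduceFinMk,
          hg0, hg1, hg2] at h ht ht' ⊢
        · have := hp.inj _ (by omega) _ (by omega) h
          exact ⟨trivial, by omega⟩
        · have := hp.inj _ (by omega) _ (by omega) h
          omega
        · exact absurd (h ▸ hU' _ (by omega)) (hq.avoid t' ht')
        · have := hp.inj _ (by omega) _ (by omega) h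
          omega
        · have := hp.inj _ (by omega) _ (by omega) h
          exact ⟨trivial, by omega⟩
        · exact absurd (h ▸ hU' _ (by omega)) (hq.avoid t' ht')
        · exact absurd (h ▸ hU' _ (by omega)) (hq.avoid t ht)
        · exact absurd (h ▸ hU' _ (by omega)) (hq.avoid t ht)
        · have := hq.inj _ (by omega) _ (by omega) h
          exact ⟨trivial, by omega⟩
      obtain ⟨rfl, h2⟩ := hii
      rw [Fin.ext h2]
  refine isContained_fromEdgeSet f hf ?_
  rintro (_ | ⟨i, t⟩) (_ | ⟨i', t'⟩) h
  · exact h.elim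
  · have h0 : (t' : ℕ) = 0 := h
    have ht' := t'.2
    change s(p j, g i' t') ∈ M'
    rw [h0]
    fin_cases i' <;> simp only [Fin.zero_eta, Fin.mk_one, Fin.reduceFinMk, hg0, hg1, hg2] at ht' ⊢
    · exact hpe j (by omega)
    · have := hpe (j - 1) (by omega)
      rw [show j - 1 + 1 = j by omega] at this
      rwa [Sym2.eq_swap]
    · rw [← hq.zero]
      exact hq.edge 0 (by omega)
  · exact h.elim
  · obtain ⟨rfl, h1⟩ : i = i' ∧ (t' : ℕ) = t + 1 := h
    have ht' := t'.2
    change s(g i t, g i t') ∈ M'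
    rw [h1]
    fin_cases i <;> simp only [Fin.zero_eta, Fin.mk_one, Fin.reduceFinMk, hg0, hg1, hg2] at ht' ⊢
    · exact hpe (j + 1 + t) (by omega)
    · have := hpe (j - 1 - (t + 1)) (by omega)
      rw [show j - 1 - ((t : ℕ) + 1) + 1 = j - 1 - t by omega] at this
      rwa [Sym2.eq_swap]
    · exact hq.edge _ (by omega)

end Maker

/-! ### The clever Maker wins below `n` -/

section MakerWins

theorem graphProbCC_eq_one {V : Type*} {H : SimpleGraph V} {n b K : ℕ}
    {P : Finset (Sym2 (Fin n)) → Finset (Sym2 (Fin n)) → Prop}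
    (h : CanForce (board n) b P K ∅ ∅)
    (hP : ∀ M B, P M B →
      H.IsContained (SimpleGraph.fromEdgeSet (M : Set (Sym2 (Fin n))))) :
    graphProbCC (containsSubgraph H) n b = 1 := by
  rw [graphProbCC, probCC, if_pos]
  exact h.makerHasWinningStrategy fun M B hM M' hMM' => containsSubgraph_mono hMM' (hP M B hM)

theorem edgeDegree_empty {V : Type*} [Fintype V] [DecidableEq V] (v : V) :
    edgeDegree ∅ v = 0 := by
  simp [edgeDegree]

theorem canForce_path {n b δ u β : ℕ} (v : Fin n)
    (hn : ∀ h, h * (δ + 1) ≤ 2 * β → b + δ + u + h < n) {K : ℕ} (hu : 1 + K ≤ u)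
    (hβ : K * b ≤ β) :
    CanForce (board n) b (fun M B => (∃ p, PathExtension {v} ∅ M v K p) ∧ B.card ≤ K * b)
      K ∅ ∅ := by
  simpa using canForce_pathExtension hn K {v} v ∅ ∅ (by simp) (by simp)
    (by simp [edgeDegree_empty]) (by simpa using hu) (by simpa using hβ)

theorem graphProbCC_path {V : Type*} {H : SimpleGraph V} {k : ℕ} (hH : IsPathWithEdges H k)
    {n b δ : ℕ} (hn : ∀ h, h * (δ + 1) ≤ 2 * (k * b) → b + δ + (1 + k) + h < n) :
    graphProbCC (containsSubgraph H) n b = 1 := by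
  have hn0 := hn 0 (by simp)
  refine graphProbCC_eq_one (canForce_path ⟨0, by omega⟩ hn le_rfl le_rfl) ?_
  rintro M B ⟨⟨p, hp⟩, -⟩
  obtain ⟨φ⟩ := hH
  exact SimpleGraph.IsContained.trans ⟨φ.toCopy⟩ hp.pathGraph_isContained

/-- Maker first builds a path with `K` edges, then starts the third leg at a path vertex of low
Breaker degree that leaves enough path on either side for the other two legs. -/
theorem canForce_spider {n b δ K : ℕ} (ℓ : Fin 3 → ℕ)
    (hn : ∀ h, h * (δ + 1) ≤ 2 * ((K + ℓ 2) * b) → b + δ + (1 + K + ℓ 2) + h < n)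
    (hK : ℓ 0 + ℓ 1 ≤ K)
    (hdeg : K * b + (K + 1) ^ 2 < (K + 1 - (ℓ 0 + ℓ 1)) * (b + δ + 1)) :
    CanForce (board n) b (fun M _ => (spider ℓ).IsContained
      (SimpleGraph.fromEdgeSet (M : Set (Sym2 (Fin n))))) (K + ℓ 2) ∅ ∅ := by
  have hn0 := hn 0 (by simp)
  have hpath := canForce_path ⟨0, by omega⟩ hn (K := K) (by omega)
    (Nat.mul_le_mul_right _ (Nat.le_add_right _ _))
  refine hpath.trans ?_
  rintro M B ⟨⟨p, hp⟩, hB⟩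
  set U := (Finset.range (K + 1)).image p with hU
  have hpinj : Set.InjOn p (Finset.range (K + 1)) := by
    intro i hi j hj hij
    simp only [Finset.coe_range, Set.mem_Iio] at hi hj
    exact hp.inj i (by omega) j (by omega) hij
  have hUc : U.card = K + 1 := by
    rw [hU, Finset.card_image_of_injOn hpinj, Finset.card_range]
  have hpU : ∀ i ≤ K, p i ∈ U := fun i hi =>
    Finset.mem_image_of_mem p (Finset.mem_range.2 (by omega))
  -- Averaging: if all `K + 1 - (ℓ 0 + ℓ 1)` candidates had degree above `b + δ`, the degree sum on
  -- the path would exceed `K b + (K + 1)²`.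
  obtain ⟨j, hj0, hj1, hjd⟩ : ∃ j, j + ℓ 0 ≤ K ∧ ℓ 1 ≤ j ∧ edgeDegree B (p j) ≤ b + δ := by
    by_contra! hall
    have hsub : Finset.Icc (ℓ 1) (K - ℓ 0) ⊆ Finset.range (K + 1) := by
      intro i hi
      rw [Finset.mem_Icc] at hi
      rw [Finset.mem_range]
      omega
    have h1 : (K + 1 - (ℓ 0 + ℓ 1)) * (b + δ + 1) ≤ ∑ v ∈ U, edgeDegree B v := by
      calc (K + 1 - (ℓ 0 + ℓ 1)) * (b + δ + 1)
          = ∑ i ∈ Finset.Icc (ℓ 1) (K - ℓ 0), (b + δ + 1) := by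
            rw [Finset.sum_const, Nat.card_Icc, smul_eq_mul]
            congr 1
            omega
        _ ≤ ∑ i ∈ Finset.Icc (ℓ 1) (K - ℓ 0), edgeDegree B (p i) := by
            refine Finset.sum_le_sum fun i hi => ?_
            rw [Finset.mem_Icc] at hi
            exact hall i (by omega) hi.1
        _ ≤ ∑ i ∈ Finset.range (K + 1), edgeDegree B (p i) :=
            Finset.sum_le_sum_of_subset hsub
        _ = _ := by rw [hU, Finset.sum_image hpinj]
    have h2 := sum_edgeDegree_le_add_sq B U
    rw [hUc] at h2
    omega
  refine (canForce_pathExtension hn (ℓ 2) U (p j) M B (hpU j (by omega)) ?_ hjd (by omega)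
    (by rw [add_mul]; omega)).mono ?_
  · intro e he x hx
    rcases hp.inside e he x hx with hx | ⟨i, hi, rfl⟩
    · rw [Finset.mem_singleton] at hx
      rw [hx, ← hp.zero]
      exact hpU 0 (by omega)
    · exact hpU i hi
  · rintro M' B' ⟨⟨q, hq⟩, -⟩
    exact spider_isContained ℓ hp hq hpU hj0 hj1

/-- The numerical condition of `canForce_pathExtension` for large `n`. -/
theorem eventually_room {ε : ℝ} (hε : 0 < ε) (u c : ℕ) :
    ∀ᶠ n : ℕ in atTop, ∀ b : ℕ, (b : ℝ) ≤ (1 - ε) * n →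
      ∀ h, h * (⌊ε * n / 4⌋₊ + 1) ≤ 2 * (c * b) → b + ⌊ε * n / 4⌋₊ + u + h < n := by
  filter_upwards [tendsto_natCast_atTop_atTop.eventually_gt_atTop
    ((u + 8 * c / ε) * (4 / (3 * ε))), eventually_gt_atTop 0] with n hn hn0 b hb h hh
  have hn0' : (0 : ℝ) < n := by exact_mod_cast hn0
  have h1 : (⌊ε * n / 4⌋₊ : ℝ) ≤ ε * n / 4 := Nat.floor_le (by positivity)
  have h2 : ε * n / 4 < ⌊ε * n / 4⌋₊ + 1 := Nat.lt_floor_add_one _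
  have hh' : (h : ℝ) * (⌊ε * n / 4⌋₊ + 1) ≤ 2 * (c * b) := by exact_mod_cast hh
  have hbn : (b : ℝ) ≤ n := by nlinarith
  have h3 : (h : ℝ) * (ε * n / 4) ≤ 2 * (c * n) :=
    calc (h : ℝ) * (ε * n / 4) ≤ h * (⌊ε * n / 4⌋₊ + 1) := by gcongr
      _ ≤ 2 * (c * b) := hh'
      _ ≤ _ := by gcongr
  -- The number of high-degree vertices is bounded independently of `n`; the bias and `δ` leave `3 ε
  -- n / 4` vertices, enough for `u + h`.
  have h4 : (h : ℝ) ≤ 8 * c / ε := by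
    rw [le_div_iff₀ hε]
    refine le_of_mul_le_mul_right (a := (n : ℝ)) ?_ hn0'
    linarith
  have h5 : (u + 8 * c / ε) < 3 * ε / 4 * n := by
    have h6 : (u + 8 * c / ε) * (4 / (3 * ε)) * (3 * ε / 4) < n * (3 * ε / 4) := by gcongr
    have h7 : (u + 8 * c / ε) * (4 / (3 * ε)) * (3 * ε / 4) = u + 8 * c / ε := by
      field_simp
    linarith
  have : ((b + ⌊ε * n / 4⌋₊ + u + h : ℕ) : ℝ) < n := by
    push_cast
    linarith
  exact_mod_cast this

theorem exists_eventually_degree {ε : ℝ} (hε : 0 < ε) (L : ℕ) :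
    ∃ K, L ≤ K ∧ ∀ᶠ n : ℕ in atTop, ∀ b : ℕ, (b : ℝ) ≤ (1 - ε) * n →
      K * b + (K + 1) ^ 2 < (K + 1 - L) * (b + ⌊ε * n / 4⌋₊ + 1) := by
  -- With this `J`, `J` times the slack `ε n / 4` is at least `(L + 1) n`. This covers the `L b`
  -- lost on excluded positions and leaves `n` to beat the constant square.
  obtain ⟨J, hJ⟩ := exists_nat_ge ((L + 1 : ℝ) * (4 / ε))
  refine ⟨L + J, Nat.le_add_right _ _, ?_⟩
  filter_upwards [eventually_gt_atTop ((L + J + 1) ^ 2)] with n hn b hb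
  have hn' : ((L + J + 1 : ℕ) : ℝ) ^ 2 < n := by exact_mod_cast hn
  have hn0 : (0 : ℝ) ≤ n := Nat.cast_nonneg _
  rw [show L + J + 1 - L = J + 1 by omega]
  have h2 : ε * n / 4 < ⌊ε * n / 4⌋₊ + 1 := Nat.lt_floor_add_one _
  have hbn : (b : ℝ) ≤ n := by nlinarith
  have hJ0 : (L + 1 : ℝ) * n ≤ J * (ε * n / 4) := by
    have h3 : (L + 1 : ℝ) * (4 / ε) * (ε * n / 4) ≤ J * (ε * n / 4) := by gcongr
    have h4 : (L + 1 : ℝ) * (4 / ε) * (ε * n / 4) = (L + 1) * n := by field_simp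
    linarith
  have h5 : (J : ℝ) * (ε * n / 4) ≤ J * (⌊ε * n / 4⌋₊ + 1) := by gcongr
  have h6 : (L : ℝ) * b ≤ L * n := by gcongr
  have hb0 : (0 : ℝ) ≤ b := Nat.cast_nonneg _
  have hf0 : (0 : ℝ) ≤ ⌊ε * n / 4⌋₊ := Nat.cast_nonneg _
  have : (((L + J) * b + (L + J + 1) ^ 2 : ℕ) : ℝ) <
      (((J + 1) * (b + ⌊ε * n / 4⌋₊ + 1) : ℕ) : ℝ) := by
    push_cast at hn' ⊢
    linarith
  exact_mod_cast this

/-- CleverMaker wins whenever the bias is at most `(1 - ε) n` and `n` is large. -/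
theorem eventually_graphProbCC_eq_one {V : Type*} {H : SimpleGraph V}
    (hH : (∃ k, IsPathWithEdges H k) ∨ IsThreeLeggedSpider H) {ε : ℝ} (hε : 0 < ε) :
    ∀ᶠ n : ℕ in atTop, ∀ b : ℕ, (b : ℝ) ≤ (1 - ε) * n →
      graphProbCC (containsSubgraph H) n b = 1 := by
  rcases hH with ⟨k, hk⟩ | ⟨ℓ, -, ⟨φ⟩⟩
  · filter_upwards [eventually_room hε (1 + k) k] with n hn b hb
    exact graphProbCC_path hk (hn b hb)
  · obtain ⟨K, hK, hdeg⟩ := exists_eventually_degree hε (ℓ 0 + ℓ 1)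
    filter_upwards [eventually_room hε (1 + K + ℓ 2) (K + ℓ 2), hdeg] with n hn hd b hb
    exact graphProbCC_eq_one (canForce_spider ℓ (hn b hb) hK (hd b hb)) fun M B hM =>
      SimpleGraph.IsContained.trans ⟨φ.toCopy⟩ hM

end MakerWins

/-! ### Comparing the two thresholds -/

section Thresholds

variable {V : Type*} {H : SimpleGraph V}

theorem isSharpThreshold_graphProbCC
    (hH : (∃ k, IsPathWithEdges H k) ∨ IsThreeLeggedSpider H)
    (h10 : (SimpleGraph.pathGraph 11).IsContained H) :
    IsSharpThreshold (graphProbCC (containsSubgraph H)) fun n => (n : ℝ) := by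
  intro ε hε
  refine ⟨fun hε1 => ?_, ?_⟩
  · refine tendsto_const_nhds.congr' ?_
    filter_upwards [eventually_graphProbCC_eq_one hH hε] with n hn
    exact (hn _ (Nat.floor_le (mul_nonneg (by linarith) (Nat.cast_nonneg _)))).symm
  · refine tendsto_const_nhds.congr fun n => ?_
    refine (graphProbCC_eq_zero h10 (Nat.le_floor ?_)).symm
    nlinarith [(Nat.cast_nonneg n : (0 : ℝ) ≤ n)]

/-- A sharp threshold of CleverMaker is asymptotically equal to `n`, which puts RandomMaker with a
slightly smaller bias into the range of `graphProbRC_le`. -/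
theorem not_isSharpThreshold_graphProbRC
    (hH : (∃ k, IsPathWithEdges H k) ∨ IsThreeLeggedSpider H)
    (h10 : (SimpleGraph.pathGraph 11).IsContained H) {f : ℕ → ℝ}
    (hf : IsSharpThreshold (graphProbCC (containsSubgraph H)) f) :
    ¬ IsSharpThreshold (graphProbRC (containsSubgraph H)) f := by
  intro hR
  have hδ : (0 : ℝ) < 1 / 400 := by norm_num
  have hRC := (hR (1 / 400) hδ).1 (by norm_num)
  have hlow := ((hf (1 / 400) hδ).1 (by norm_num)).eventually_ne one_ne_zero
  have hup := (hf (1 / 400) hδ).2.eventually_ne zero_ne_one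
  have hgt := hRC.eventually_const_lt (u := 1 / 2) (by
    rw [one_div]; exact ENNReal.inv_lt_one.2 (by norm_num))
  -- Failure along multiples of 100 already excludes convergence to 1.
  have hmul : Tendsto (fun m : ℕ => 100 * m) atTop atTop :=
    tendsto_id.const_mul_atTop' (by norm_num)
  obtain ⟨m, ⟨⟨⟨h1, h2⟩, h3⟩, h4⟩, h5⟩ := ((hmul.eventually (((hlow.and hup).and hgt).and
    (eventually_graphProbCC_eq_one hH hδ))).and (eventually_ge_atTop 10)).exists
  set b := ⌊(1 - 1 / 400) * f (100 * m)⌋₊ with hb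
  have hm : (10 : ℝ) ≤ m := by exact_mod_cast h5
  have hb1 : b ≤ 100 * m := by
    by_contra hlt
    exact h1 (graphProbCC_eq_zero h10 (by omega))
  have hf1 : (1 - 1 / 400) * ((100 * m : ℕ) : ℝ) < (1 + 1 / 400) * f (100 * m) := by
    by_contra hle
    push Not at hle
    refine h2 (h4 _ ?_)
    rcases le_total 0 ((1 + 1 / 400) * f (100 * m)) with h0 | h0
    · exact (Nat.floor_le h0).trans hle
    · rw [Nat.floor_of_nonpos h0, Nat.cast_zero]
      positivity
  push_cast at hf1
  -- The choice of `1/400` works because `(399/400)² / (401/400)` exceeds `99/100`.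
  have hb2 : 99 * m ≤ b := by
    refine Nat.le_floor ?_
    push_cast
    linarith
  exact absurd h3 (not_lt.2 (graphProbRC_le h10 (by omega) hb2 hb1))

theorem pathGraph_isContained_of_le {k l : ℕ} (h : k ≤ l) :
    (SimpleGraph.pathGraph k).IsContained (SimpleGraph.pathGraph l) := by
  refine ⟨⟨⟨Fin.castLE h, ?_⟩, Fin.castLE_injective h⟩⟩
  intro i j hij
  rw [SimpleGraph.pathGraph_adj] at hij ⊢
  simpa using hij

end Thresholds

end BiasedGame

theorem corollary3 {V : Type*} (H : SimpleGraph V)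
    (hH : (∃ k : ℕ, 10 ≤ k ∧ BiasedGame.IsPathWithEdges H k) ∨
      (BiasedGame.IsThreeLeggedSpider H ∧ (SimpleGraph.pathGraph 11).IsContained H)) :
    BiasedGame.IsSharpThreshold
        (BiasedGame.graphProbCC (BiasedGame.containsSubgraph H)) (fun n => (n : ℝ)) ∧
      ¬ BiasedGame.IsSharpThreshold
        (BiasedGame.graphProbRC (BiasedGame.containsSubgraph H)) (fun n => (n : ℝ)) ∧
      ¬ ∃ f : ℕ → ℝ,
        BiasedGame.IsSharpThreshold
            (BiasedGame.graphProbCC (BiasedGame.containsSubgraph H)) f ∧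
          BiasedGame.IsSharpThreshold
            (BiasedGame.graphProbRC (BiasedGame.containsSubgraph H)) f := by
  have h10 : (SimpleGraph.pathGraph 11).IsContained H := by
    rcases hH with ⟨k, hk, ⟨φ⟩⟩ | ⟨-, h⟩
    · exact (BiasedGame.pathGraph_isContained_of_le (by omega)).trans ⟨φ.symm.toCopy⟩
    · exact h
  have hH' : (∃ k, BiasedGame.IsPathWithEdges H k) ∨ BiasedGame.IsThreeLeggedSpider H :=
    hH.imp (fun ⟨k, _, h⟩ => ⟨k, h⟩) And.left
  have hCC := BiasedGame.isSharpThreshold_graphProbCC hH' h10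
  exact ⟨hCC, BiasedGame.not_isSharpThreshold_graphProbRC hH' h10 hCC, fun ⟨_, h1, h2⟩ =>
    BiasedGame.not_isSharpThreshold_graphProbRC hH' h10 h1 h2⟩
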